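/- Let $q$ be an odd prime power, let $F=\mathrm{GF}(q^2)$, let $\sigma\colon x\mapsto x^q$ be the automorphism of $F$ of order $2$, and for a matrix $A$ over $F$ let $A^\sigma$ be obtained by applying $\sigma$ to every entry. Let $J=\mathrm{GL}(2,F)\rtimes Z_2$ with multiplication $(A,i)(B,j)=(AB^{\sigma^i},i+j)$, let $L=\{(\delta I,0):\delta\in F^*\}$, and let $K=\{(A,\iota_A):A\in \mathrm{GL}(2,F)\}$, where $\iota_A=0$ if $\det A$ is a square in $F$ and $\iota_A=1$ otherwise. Put $\overline{G}=J/L$, let $G=M(q^2)=K/L\le\overline{G}$ be the twisted linear fractional group, and write $[A,i]$ for the coset $(A,i)L$. A pair $([A,1],[B,1])$ of elements of $G$ is called non-singular if $A$ and $B$ can be chosen in one of the forms (D) $B=\begin{pmatrix}\lambda&0\\0&1\end{pmatrix}$, $A=\begin{pmatrix}-1&b\\c&\lambda^\sigma\end{pmatrix}$, where $\lambda$ and $bc+\lambda^\sigma$ are non-squares of $F$, or (O) $B=\begin{pmatrix}0&\lambda\\1&0\end{pmatrix}$, $A=\begin{pmatrix}a&\lambda^\sigma\\-1&d\end{pmatrix}$,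 where $\lambda$ and $ad+\lambda^\sigma$ are non-squares of $F$ (in both cases the product $[A,1][B,1]$ has order $2$), and none of the following holds: (i) both $[A,1]$ and $[B,1]$ have order $4$; (ii) the form is (D) and $A$ is upper or lower triangular, i.e. $bc=0$; (iii) the form is (O) and $A$ is off-diagonal, i.e. $a=d=0$. Then the number of orbits of non-singular pairs in $G$ under simultaneous conjugation by elements of $\overline{G}$ (that is, the number of orbits of $\overline{G}$ on $G\times G$ that contain a non-singular pair) is equal to $$\frac{(q^2-1)(q^2-2)}{8}.$$ -/

import Mathlib

open scoped Matrix

namespace TwistedLinear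

section Automorphism

variable {F : Type*} [Field F] [Finite F] {q : ℕ}

theorem pow_pow_card (hF : Nat.card F = q ^ 2) (x : F) : (x ^ q) ^ q = x := by
  have := Fintype.ofFinite F
  rw [← pow_mul, ← sq, ← hF, Nat.card_eq_fintype_card]
  exact FiniteField.pow_card x

theorem add_pow_card (hF : Nat.card F = q ^ 2) (x y : F) :
    (x + y) ^ q = x ^ q + y ^ q := by
  have := Fintype.ofFinite F
  obtain ⟨p, hp⟩ := CharP.exists F
  obtain ⟨n, hpp, hn⟩ := FiniteField.card F p
  have : Fact p.Prime := ⟨hpp⟩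
  have hd : q ∣ p ^ (n : ℕ) := by
    rw [← hn, ← Nat.card_eq_fintype_card, hF]
    exact Dvd.intro_left (q ^ Nat.succ 0) (by ring)
  obtain ⟨k, -, rfl⟩ := (Nat.dvd_prime_pow hpp).1 hd
  exact add_pow_char_pow x y p k

theorem card_base_ne_zero (hF : Nat.card F = q ^ 2) : q ≠ 0 := by
  rintro rfl
  exact Nat.card_pos.ne' (hF.trans (by norm_num) : Nat.card F = 0)

/-- The automorphism `σ : x ↦ x ^ q` of the field `F` of order `q ^ 2`. -/
def sigma (hF : Nat.card F = q ^ 2) : F ≃+* F where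
  toFun x := x ^ q
  invFun x := x ^ q
  left_inv := pow_pow_card hF
  right_inv := pow_pow_card hF
  map_mul' x y := mul_pow x y q
  map_add' := add_pow_card hF

/-- The matrix `A ^ σ`, obtained by applying `σ` to every entry of `A`,
as an automorphism of `GL(2, F)`. -/
def sigmaGL (hF : Nat.card F = q ^ 2) : MulAut (GL (Fin 2) F) :=
  Units.mapEquiv (sigma hF).mapMatrix.toMulEquiv

theorem sigmaGL_apply (hF : Nat.card F = q ^ 2) (A : GL (Fin 2) F) (i j : Fin 2) :
    (sigmaGL hF A : Matrix (Fin 2) (Fin 2) F) i j = (A : Matrix (Fin 2) (Fin 2) F) i j ^ q :=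
  rfl

theorem sigmaGL_sigmaGL (hF : Nat.card F = q ^ 2) : sigmaGL hF * sigmaGL hF = 1 := by
  ext A i j
  exact pow_pow_card hF _

theorem det_sigmaGL (hF : Nat.card F = q ^ 2) (A : GL (Fin 2) F) :
    (sigmaGL hF A : Matrix (Fin 2) (Fin 2) F).det
      = sigma hF (A : Matrix (Fin 2) (Fin 2) F).det :=
  (RingEquiv.map_det (sigma hF) _).symm

end Automorphism

section DetClass

variable {F : Type*} [Field F]

/-- The group `Z₂ = {0, 1}`, written multiplicatively. -/
abbrev Z2 : Type := Multiplicative (ZMod 2)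

/-- The element `1` of `Z₂ = {0, 1}` (the generator). -/
abbrev Z2.one : Z2 := Multiplicative.ofAdd 1

open Classical in
/-- `ι_A`: it is `0` if `det A` is a square in `F` and `1` if it is a non-square. -/
noncomputable def iota (A : GL (Fin 2) F) : Z2 :=
  if IsSquare (A : Matrix (Fin 2) (Fin 2) F).det then 1 else Z2.one

theorem iota_eq_one_iff (A : GL (Fin 2) F) :
    iota A = 1 ↔ IsSquare (A : Matrix (Fin 2) (Fin 2) F).det := by
  have h1 : Z2.one ≠ 1 := by decide
  unfold iota
  split_ifs with h <;> simp [h, h1]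

theorem iota_eq_iff (A B : GL (Fin 2) F) : iota A = iota B ↔ (iota A = 1 ↔ iota B = 1) := by
  have h : ∀ i j : Z2, i = j ↔ (i = 1 ↔ j = 1) := by decide
  exact h _ _

theorem det_coe_ne_zero (A : GL (Fin 2) F) : (A : Matrix (Fin 2) (Fin 2) F).det ≠ 0 :=
  ((Matrix.isUnit_iff_isUnit_det _).1 A.isUnit).ne_zero

end DetClass

section Groups

variable {F : Type*} [Field F] [Finite F] {q : ℕ}

/-- The action of `Z₂` on `GL(2, F)`: `0` acts trivially and `1` acts by `σ`. -/
def twist (hF : Nat.card F = q ^ 2) : Z2 →* MulAut (GL (Fin 2) F) where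
  toFun i := if i = 1 then 1 else sigmaGL hF
  map_one' := if_pos rfl
  map_mul' i j := by
    have h : ∀ i : Z2, i = 1 ∨ i = Z2.one := by decide
    have h1 : Z2.one ≠ 1 := by decide
    have h2 : Z2.one * Z2.one = 1 := by decide
    rcases h i with rfl | rfl <;> rcases h j with rfl | rfl <;>
      simp [h1, h2, sigmaGL_sigmaGL]

/-- `J = GL(2, F) ⋊ Z₂`, with `(A, i) (B, j) = (A B ^ (σ ^ i), i + j)`. -/
abbrev J (hF : Nat.card F = q ^ 2) : Type _ := GL (Fin 2) F ⋊[twist hF] Z2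

theorem isSquare_mul_iff {a b : F} (ha : a ≠ 0) (hb : b ≠ 0) :
    IsSquare (a * b) ↔ (IsSquare a ↔ IsSquare b) := by
  classical
  have := Fintype.ofFinite F
  rw [← quadraticChar_one_iff_isSquare ha, ← quadraticChar_one_iff_isSquare hb,
    ← quadraticChar_one_iff_isSquare (mul_ne_zero ha hb), map_mul]
  rcases quadraticChar_dichotomy ha with h | h <;>
    rcases quadraticChar_dichotomy hb with h' | h' <;> rw [h, h'] <;> decide

theorem iota_mul (A B : GL (Fin 2) F) : iota (A * B) = iota A * iota B := by
  have h : ∀ i j k : Z2, (i = 1 ↔ (j = 1 ↔ k = 1)) → i = j * k := by decide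
  apply h
  rw [iota_eq_one_iff, iota_eq_one_iff, iota_eq_one_iff, Units.val_mul, Matrix.det_mul]
  exact isSquare_mul_iff (det_coe_ne_zero A) (det_coe_ne_zero B)

theorem iota_sigmaGL (hF : Nat.card F = q ^ 2) (A : GL (Fin 2) F) :
    iota (sigmaGL hF A) = iota A := by
  rw [iota_eq_iff, iota_eq_one_iff, iota_eq_one_iff, det_sigmaGL]
  constructor
  · intro h
    simpa using h.map (sigma hF).symm
  · intro h
    exact h.map (sigma hF)

theorem iota_twist (hF : Nat.card F = q ^ 2) (i : Z2) (A : GL (Fin 2) F) :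
    iota (twist hF i A) = iota A := by
  by_cases h : i = 1
  · simp [h]
  · have : twist hF i = sigmaGL hF := if_neg h
    rw [this, iota_sigmaGL]

/-- The homomorphism `(A, i) ↦ ι_A + i` from `J` to `Z₂`. -/
noncomputable def parity (hF : Nat.card F = q ^ 2) : J hF →* Z2 where
  toFun x := iota x.left * x.right
  map_one' := by
    have : iota (1 : GL (Fin 2) F) = 1 := by rw [iota_eq_one_iff]; simp
    simp [this]
  map_mul' x y := by
    rw [SemidirectProduct.mul_left, SemidirectProduct.mul_right, iota_mul, iota_twist]
    exact mul_mul_mul_comm _ _ _ _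

/-- `K = {(A, ι_A) : A ∈ GL(2, F)}`, a subgroup of `J`. -/
noncomputable def K (hF : Nat.card F = q ^ 2) : Subgroup (J hF) :=
  ((parity hF).ker).copy {x | x.right = iota x.left} (by
    have h : ∀ i j : Z2, j = i ↔ i * j = 1 := by decide
    ext x
    exact h _ _)

theorem mem_K (hF : Nat.card F = q ^ 2) (x : J hF) : x ∈ K hF ↔ x.right = iota x.left :=
  Iff.rfl

instance normal_K (hF : Nat.card F = q ^ 2) : (K hF).Normal := by
  rw [K, Subgroup.copy_eq]
  infer_instance

theorem sigmaGL_scalar (hF : Nat.card F = q ^ 2) (d : Fˣ) :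
    sigmaGL hF (Matrix.GeneralLinearGroup.scalar (Fin 2) d)
      = Matrix.GeneralLinearGroup.scalar (Fin 2) (d ^ q) := by
  have := card_base_ne_zero hF
  ext i j
  rw [sigmaGL_apply]
  fin_cases i <;> fin_cases j <;> simp [Matrix.diagonal_pow, this]

/-- `L = {(D, 0) : D a non-zero scalar matrix}`, a subgroup of `J`. -/
def L (hF : Nat.card F = q ^ 2) : Subgroup (J hF) :=
  ((SemidirectProduct.inl : GL (Fin 2) F →* J hF).comp
    (Matrix.GeneralLinearGroup.scalar (Fin 2))).range

instance normal_L (hF : Nat.card F = q ^ 2) : (L hF).Normal := by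
  refine ⟨?_⟩
  rintro _ ⟨d, rfl⟩ g
  obtain ⟨e, he⟩ : ∃ e : Fˣ, twist hF g.right (Matrix.GeneralLinearGroup.scalar (Fin 2) d)
      = Matrix.GeneralLinearGroup.scalar (Fin 2) e := by
    by_cases h : g.right = 1
    · exact ⟨d, by simp [h]⟩
    · have : twist hF g.right = sigmaGL hF := if_neg h
      exact ⟨d ^ q, by rw [this, sigmaGL_scalar]⟩
  have hc : g.left * Matrix.GeneralLinearGroup.scalar (Fin 2) e
      = Matrix.GeneralLinearGroup.scalar (Fin 2) e * g.left :=
    (Matrix.GeneralLinearGroup.scalar_commute e g.left).symm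
  refine ⟨e, ?_⟩
  rw [eq_mul_inv_iff_mul_eq]
  ext1
  · simp [he, hc]
  · simp

/-- `Ḡ = J / L`. -/
abbrev GBar (hF : Nat.card F = q ^ 2) : Type _ := J hF ⧸ L hF

/-- The element `[A, i]` of `Ḡ`, that is, the coset `(A, i) L`. -/
def cls (hF : Nat.card F = q ^ 2) (A : GL (Fin 2) F) (i : Z2) : GBar hF :=
  QuotientGroup.mk (⟨A, i⟩ : J hF)

/-- The twisted linear group `G = M(q ^ 2) = K / L`, as a subgroup of `Ḡ = J / L`. -/
noncomputable def M (hF : Nat.card F = q ^ 2) : Subgroup (GBar hF) :=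
  (K hF).map (QuotientGroup.mk' (L hF))

instance normal_M (hF : Nat.card F = q ^ 2) : (M hF).Normal :=
  (normal_K hF).map _ (QuotientGroup.mk'_surjective _)

end Groups

section Pairs

variable {F : Type*} [Field F] [Finite F] {q : ℕ}

/-- `B = dia(l, 1)` and `A` has rows `(-1, b)`, `(c, l ^ σ)`, where `l` and `b c + l ^ σ` are
non-squares of `F`. -/
def DiagonalForm (hF : Nat.card F = q ^ 2) (A B : Matrix (Fin 2) (Fin 2) F) : Prop :=
  ∃ l b c : F, ¬ IsSquare l ∧ ¬ IsSquare (b * c + sigma hF l) ∧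
    B = !![l, 0; 0, 1] ∧ A = !![-1, b; c, sigma hF l]

/-- `B = off(l, 1)` and `A` has rows `(a, l ^ σ)`, `(-1, d)`, where `l` and `a d + l ^ σ` are
non-squares of `F`. -/
def OffDiagonalForm (hF : Nat.card F = q ^ 2) (A B : Matrix (Fin 2) (Fin 2) F) : Prop :=
  ∃ l a d : F, ¬ IsSquare l ∧ ¬ IsSquare (a * d + sigma hF l) ∧
    B = !![0, l; 1, 0] ∧ A = !![a, sigma hF l; -1, d]

/-- `([A, 1], [B, 1])` is a non-singular pair of elements of `G = M(q ^ 2)`: `A` and `B` may be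
chosen of one of the two forms above; not both of `[A, 1]`, `[B, 1]` have order `4`;
`A` is not upper or lower triangular if `B` is diagonal; and `A` is not
off-diagonal if `B` is off-diagonal. -/
def NonSingular (hF : Nat.card F = q ^ 2) (z : M hF × M hF) : Prop :=
  ∃ A B : GL (Fin 2) F,
    (z.1 : GBar hF) = cls hF A Z2.one ∧ (z.2 : GBar hF) = cls hF B Z2.one ∧
    ¬ (orderOf z.1 = 4 ∧ orderOf z.2 = 4) ∧
    ((DiagonalForm hF A B ∧ ¬ (A 1 0 = 0 ∨ A 0 1 = 0)) ∨
      (OffDiagonalForm hF A B ∧ ¬ (A 0 0 = 0 ∧ A 1 1 = 0)))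

/-- The set of orbits of non-singular pairs, under simultaneous conjugation of
pairs of elements of `G` by elements of `Ḡ`. -/
def nonSingularOrbits (hF : Nat.card F = q ^ 2) : Set (Set (M hF × M hF)) :=
  {O | ∃ z : M hF × M hF, NonSingular hF z ∧ O = MulAction.orbit (ConjAct (GBar hF)) z}

end Pairs

end TwistedLinear

/-!
Write `N = q ^ 2 - 1`, and let `X` be the set of non-singular pairs, that is, of pairs of elements
of `G` which are literally represented by matrices of one of the two forms. The number of orbits is
computed as `|X| / (4 N)`.

The square `[B, 1] ^ 2` is represented by a diagonal, non-scalar matrix in both forms. Hence an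
element of `Ḡ` that carries one pair of `X` to another is represented by a monomial matrix
(`mem_monomialSet_of_smul`), and there are `4 N` monomial classes `[dia(u, 1), i]`,
`[off(u, 1), i]` (`ncard_monomialSet`). Conversely the monomial classes preserve `X`
(`nonSingular_smul_of_mem`). A non-singular pair has trivial stabilizer (`eq_one_of_smul_eq`): an
equation saying that a monomial class fixes it makes a non-square `l` a square, or makes `A`
triangular or off-diagonal, or makes both members of the pair have order four, and all of these are
excluded. So every orbit of a non-singular pair meets `X` in exactly `4 N` pairs
(`ncard_orbits_mul_ncard`).

It remains to see that `2 |X| = N ^ 3 - N ^ 2`. The normalization of the matrices makes the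
parameters `(l, b, c)` and `(l, a, d)` unique. Without the condition on orders there are
`N ^ 3 / 2` admissible parameters (`ncard_params`). An element `[A, 1]` has order four exactly when
`A A ^ σ` has trace zero (`orderOf_cls_eq_four_iff`), so the pairs with both members of order four
are described by norm and trace equations. These have `N ^ 2` solutions, for exactly half of which
`b c + l ^ σ`, or `a d + l ^ σ`, is a non-square, because an explicit inversion of the parameters
interchanges squares and non-squares (`two_mul_ncard_orderFour`).
-/

namespace TwistedLinear

/-! ### Counting orbits of a partially free action -/

section OrbitCount

/-- If every orbit meeting `X` does so in a translate `T • z`, and points of `X` have trivial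
stabilizers, then `X` is partitioned into sets of size `|T|`, one for each orbit. -/
theorem ncard_orbits_mul_ncard {G α : Type*} [Group G] [MulAction G α] [Finite α]
    {X : Set α} {T : Set G} (hmaps : ∀ z ∈ X, ∀ g ∈ T, g • z ∈ X)
    (hmem : ∀ z ∈ X, ∀ g : G, g • z ∈ X → g ∈ T)
    (hfree : ∀ z ∈ X, ∀ g : G, g • z = z → g = 1) :
    {O | ∃ z, z ∈ X ∧ O = MulAction.orbit G z}.ncard * T.ncard = X.ncard := by
  classical
  have := Fintype.ofFinite α
  have hO : {O | ∃ z, z ∈ X ∧ O = MulAction.orbit G z}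
      = ((X.toFinset.image (MulAction.orbit G) : Finset (Set α)) : Set (Set α)) := by
    ext O
    simp [eq_comm]
  rw [hO, Set.ncard_coe_finset, Set.ncard_eq_toFinset_card' X,
    Finset.card_eq_sum_card_image (MulAction.orbit G) X.toFinset, ← smul_eq_mul, ← Finset.sum_const]
  refine Finset.sum_congr rfl fun O hO => ?_
  obtain ⟨z, hz, rfl⟩ := Finset.mem_image.1 hO
  rw [Set.mem_toFinset] at hz
  have hinj : Set.InjOn (fun g : G => g • z) T := fun g _ h _ hgh => by
    have : (h⁻¹ * g) • z = z := by
      rw [mul_smul, inv_smul_eq_iff]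
      exact hgh
    exact (inv_mul_eq_one.1 (hfree z hz _ this)).symm
  rw [← hinj.ncard_image, ← Set.ncard_coe_finset]
  congr 1
  ext w
  simp only [Set.mem_image, Finset.coe_filter, Set.mem_toFinset, Set.mem_ofPred_eq]
  constructor
  · rintro ⟨g, hg, rfl⟩
    exact ⟨hmaps z hz g hg, MulAction.orbit_eq_iff.2 ⟨g, rfl⟩⟩
  · rintro ⟨hw, hzw⟩
    obtain ⟨g, rfl⟩ := MulAction.orbit_eq_iff.1 hzw
    exact ⟨g, hmem z hz g hw, rfl⟩

end OrbitCount

/-! ### Squares in the field -/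

section Squares

section

variable {F : Type*} [Field F]

theorem ne_zero_of_not_isSquare {x : F} (hx : ¬ IsSquare x) : x ≠ 0 := by
  rintro rfl
  exact hx (IsSquare.zero)

theorem isSquare_map_iff {x : F} (τ : F ≃+* F) : IsSquare (τ x) ↔ IsSquare x :=
  ⟨fun h => by simpa using h.map τ.symm, fun h => h.map τ⟩

theorem not_isSquare_inv {a : F} (ha : ¬ IsSquare a) : ¬ IsSquare a⁻¹ := fun h =>
  ha (by simpa using h.inv)

end

variable {F : Type*} [Field F] [Finite F] {q : ℕ}

theorem sigma_apply (hF : Nat.card F = q ^ 2) (x : F) : sigma hF x = x ^ q := rfl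

@[simp]
theorem sigma_sigma (hF : Nat.card F = q ^ 2) (x : F) : sigma hF (sigma hF x) = x :=
  pow_pow_card hF x

theorem ringChar_ne_two (hodd : Odd q) (hF : Nat.card F = q ^ 2) : ringChar F ≠ 2 := by
  have := Fintype.ofFinite F
  intro h
  have h2 := (FiniteField.even_card_iff_char_two (F := F)).1 h
  rw [← Nat.card_eq_fintype_card, hF] at h2
  have := Nat.odd_iff.1 (hodd.pow (n := 2))
  omega

theorem two_ne_zero' (hodd : Odd q) (hF : Nat.card F = q ^ 2) : (2 : F) ≠ 0 :=
  Ring.two_ne_zero (ringChar_ne_two hodd hF)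

theorem eq_zero_of_eq_neg (hodd : Odd q) (hF : Nat.card F = q ^ 2) {x : F} (h : x = -x) :
    x = 0 := by
  have h2 : 2 * x = 0 := by linear_combination h
  exact (mul_eq_zero.1 h2).resolve_left (two_ne_zero' hodd hF)

/-- Euler's criterion, with the exponent `(q ^ 2 - 1) / 2` factored for `q = 2 m + 1`. -/
theorem isSquare_iff_pow_eq_one {m : ℕ} (hF : Nat.card F = (2 * m + 1) ^ 2) {x : F}
    (hx : x ≠ 0) : IsSquare x ↔ x ^ ((2 * m + 2) * m) = 1 := by
  have := Fintype.ofFinite F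
  rw [FiniteField.isSquare_iff (ringChar_ne_two ⟨m, rfl⟩ hF) hx, ← Nat.card_eq_fintype_card, hF]
  have : (2 * m + 1) ^ 2 / 2 = (2 * m + 2) * m := by
    have : (2 * m + 1) ^ 2 = 2 * ((2 * m + 2) * m) + 1 := by ring
    omega
  rw [this]

theorem isSquare_neg_one (hodd : Odd q) (hF : Nat.card F = q ^ 2) : IsSquare (-1 : F) := by
  obtain ⟨m, rfl⟩ := hodd
  rw [isSquare_iff_pow_eq_one hF (neg_ne_zero.2 one_ne_zero)]
  exact Even.neg_one_pow ⟨(m + 1) * m, by ring⟩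

theorem isSquare_neg_iff (hodd : Odd q) (hF : Nat.card F = q ^ 2) {x : F} :
    IsSquare (-x) ↔ IsSquare x := by
  have h (y : F) (hy : IsSquare y) : IsSquare (-y) := by
    rw [← neg_one_mul]
    exact (isSquare_neg_one hodd hF).mul hy
  exact ⟨fun hx => neg_neg x ▸ h _ hx, h x⟩

/-- An element whose norm to `GF(q)` is a square in `GF(q)` is itself a square. -/
theorem isSquare_of_norm_eq_sq (hodd : Odd q) (hF : Nat.card F = q ^ 2) {x r : F} (hr : r ≠ 0)
    (hσ : sigma hF r = r) (h : x * sigma hF x = r ^ 2) : IsSquare x := by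
  obtain ⟨m, rfl⟩ := hodd
  have hx : x ≠ 0 := by
    rintro rfl
    exact pow_ne_zero 2 hr (by rw [← h, zero_mul])
  rw [isSquare_iff_pow_eq_one hF hx, pow_mul]
  rw [sigma_apply] at h hσ
  have h1 : x ^ (2 * m + 2) = r ^ 2 := by rw [← h]; ring
  rw [h1, ← pow_mul]
  refine mul_right_cancel₀ hr ?_
  rw [one_mul, ← pow_succ, hσ]

/-- The elements of `GF(q)` are squares in `F`. -/
theorem isSquare_of_sigma_eq (hodd : Odd q) (hF : Nat.card F = q ^ 2) {x : F}
    (hσ : sigma hF x = x) : IsSquare x := by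
  by_cases hx : x = 0
  · exact hx ▸ IsSquare.zero
  · exact isSquare_of_norm_eq_sq hodd hF hx hσ (by rw [hσ, sq])

/-- `u ^ σ / u = u ^ (q - 1)` is a square, since `q - 1` is even. -/
theorem isSquare_sigma_mul_inv (hodd : Odd q) (hF : Nat.card F = q ^ 2) (u : F) :
    IsSquare (sigma hF u * u⁻¹) := by
  obtain ⟨m, rfl⟩ := hodd
  by_cases hu : u = 0
  · simp [hu]
  · refine ⟨u ^ m, ?_⟩
    rw [sigma_apply]
    field_simp
    ring

theorem isSquare_norm (hodd : Odd q) (hF : Nat.card F = q ^ 2) (u : F) :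
    IsSquare (u * sigma hF u) :=
  isSquare_of_sigma_eq hodd hF (by rw [map_mul, sigma_sigma, mul_comm])

theorem not_isSquare_mul {a b : F} (ha : IsSquare a) (ha0 : a ≠ 0) (hb : ¬ IsSquare b) :
    ¬ IsSquare (a * b) := by
  rw [isSquare_mul_iff ha0 (ne_zero_of_not_isSquare hb)]
  tauto

end Squares

/-! ### Computing in the quotient -/

section Quotient

variable {F : Type*} [Field F] [Finite F] {q : ℕ}

/-- The field automorphism by which `i ∈ Z₂` acts on matrix entries. -/
def tau (hF : Nat.card F = q ^ 2) (i : Z2) : F ≃+* F :=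
  if i = 1 then RingEquiv.refl F else sigma hF

theorem tau_one (hF : Nat.card F = q ^ 2) (x : F) : tau hF 1 x = x := by simp [tau]

theorem tau_gen (hF : Nat.card F = q ^ 2) (x : F) : tau hF Z2.one x = sigma hF x := by
  have h1 : Z2.one ≠ 1 := by decide
  simp [tau, h1]

theorem eq_one_or_gen (i : Z2) : i = 1 ∨ i = Z2.one := by
  revert i
  decide

theorem sigma_tau (hF : Nat.card F = q ^ 2) (i : Z2) (x : F) :
    sigma hF (tau hF i x) = tau hF i (sigma hF x) := by
  rcases eq_one_or_gen i with rfl | rfl <;> simp only [tau_one, tau_gen]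

theorem coe_twist (hF : Nat.card F = q ^ 2) (i : Z2) (A : GL (Fin 2) F) :
    (twist hF i A : Matrix (Fin 2) (Fin 2) F) = (A : Matrix (Fin 2) (Fin 2) F).map (tau hF i) := by
  rcases eq_one_or_gen i with rfl | rfl
  · ext a b
    simp [tau_one]
  · ext a b
    simp only [Matrix.map_apply, tau_gen]
    rfl

theorem exists_cls (hF : Nat.card F = q ^ 2) (g : GBar hF) : ∃ A i, g = cls hF A i := by
  obtain ⟨⟨A, i⟩, rfl⟩ := QuotientGroup.mk_surjective g
  exact ⟨A, i, rfl⟩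

theorem cls_mul (hF : Nat.card F = q ^ 2) (A B : GL (Fin 2) F) (i j : Z2) :
    cls hF A i * cls hF B j = cls hF (A * twist hF i B) (i * j) := rfl

theorem cls_eq_iff (hF : Nat.card F = q ^ 2) (A B : GL (Fin 2) F) (i j : Z2) :
    cls hF A i = cls hF B j ↔
      i = j ∧ ∃ k : F, k ≠ 0 ∧
        (A : Matrix (Fin 2) (Fin 2) F) = k • (B : Matrix (Fin 2) (Fin 2) F) := by
  rw [eq_comm, cls, cls, QuotientGroup.eq]
  have key : (⟨B, j⟩ : J hF)⁻¹ * ⟨A, i⟩ ∈ L hF ↔ ∃ d : Fˣ, (⟨B, j⟩ : J hF) *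
      SemidirectProduct.inl (Matrix.GeneralLinearGroup.scalar (Fin 2) d) = ⟨A, i⟩ := by
    constructor
    · rintro ⟨d, hd⟩
      exact ⟨d, by rw [← mul_inv_cancel_left (⟨B, j⟩ : J hF) ⟨A, i⟩, ← hd]; rfl⟩
    · rintro ⟨d, hd⟩
      exact ⟨d, by rw [← hd, inv_mul_cancel_left]; rfl⟩
  rw [key]
  have hscal (e : Fˣ) : (tau hF j e) ≠ 0 := by simp
  have hmul (e : Fˣ) : ((B * twist hF j (Matrix.GeneralLinearGroup.scalar (Fin 2) e) :
      GL (Fin 2) F) : Matrix (Fin 2) (Fin 2) F) = (tau hF j e) • (B : Matrix (Fin 2) (Fin 2) F) := by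
    rw [Units.val_mul, coe_twist]
    ext a b
    fin_cases a <;> fin_cases b <;> simp [Matrix.mul_apply, mul_comm]
  constructor
  · rintro ⟨d, hd⟩
    have h1 := congrArg SemidirectProduct.left hd
    have h2 := congrArg SemidirectProduct.right hd
    simp only [SemidirectProduct.mul_left, SemidirectProduct.mul_right,
      SemidirectProduct.left_inl, SemidirectProduct.right_inl, mul_one] at h1 h2
    exact ⟨h2.symm, _, hscal d, by rw [← hmul, h1]⟩
  · rintro ⟨rfl, k, hk, hA⟩
    refine ⟨Units.mk0 ((tau hF i).symm k) (by simpa using hk), ?_⟩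
    ext1
    · apply Units.ext
      simp only [SemidirectProduct.mul_left, SemidirectProduct.left_inl]
      rw [hmul, hA]
      simp
    · simp

/-- Conjugation by `[P, i]` takes `[A, 1]` to `[A', 1]` exactly when `P A ^ τ` and `A' P ^ σ` are
proportional, where `τ = σ ^ i`. -/
theorem cls_mul_eq_iff (hF : Nat.card F = q ^ 2) (P A A' : GL (Fin 2) F) (i : Z2) :
    cls hF P i * cls hF A Z2.one = cls hF A' Z2.one * cls hF P i ↔ ∃ k : F, k ≠ 0 ∧
      (P : Matrix (Fin 2) (Fin 2) F) * (A : Matrix (Fin 2) (Fin 2) F).map (tau hF i) =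
        k • ((A' : Matrix (Fin 2) (Fin 2) F) * (P : Matrix (Fin 2) (Fin 2) F).map (sigma hF)) := by
  have h : (tau hF Z2.one : F → F) = sigma hF := funext (tau_gen hF)
  rw [cls_mul, cls_mul, cls_eq_iff, mul_comm i, Units.val_mul, Units.val_mul, coe_twist, coe_twist,
    h]
  simp

theorem cls_one (hF : Nat.card F = q ^ 2) : cls hF 1 1 = 1 := rfl

/-- By the Cayley–Hamilton theorem, `A A ^ σ` has a scalar square but is not itself scalar
exactly when it has trace zero. -/
theorem orderOf_cls_eq_four_iff (hodd : Odd q) (hF : Nat.card F = q ^ 2) (A : GL (Fin 2) F) :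
    orderOf (cls hF A Z2.one) = 4 ↔
      ((A : Matrix (Fin 2) (Fin 2) F) * (A : Matrix (Fin 2) (Fin 2) F).map (sigma hF)).trace = 0 := by
  have hgen : Z2.one * Z2.one = 1 := by decide
  have hmap : (tau hF Z2.one : F → F) = sigma hF := funext (tau_gen hF)
  have hsq : cls hF A Z2.one ^ 2 = cls hF (A * twist hF Z2.one A) 1 := by
    rw [sq, cls_mul, hgen]
  set C := A * twist hF Z2.one A with hC
  have hCv : (C : Matrix (Fin 2) (Fin 2) F) =
      (A : Matrix (Fin 2) (Fin 2) F) * (A : Matrix (Fin 2) (Fin 2) F).map (sigma hF) := by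
    rw [hC, Units.val_mul, coe_twist, hmap]
  rw [← hCv]
  have h2 : cls hF A Z2.one ^ 2 = 1 ↔ ∃ k : F, k ≠ 0 ∧
      (C : Matrix (Fin 2) (Fin 2) F) = k • (1 : Matrix (Fin 2) (Fin 2) F) := by
    rw [hsq, ← cls_one, cls_eq_iff]
    simp
  have h4 : cls hF A Z2.one ^ 4 = 1 ↔ ∃ k : F, k ≠ 0 ∧
      (C : Matrix (Fin 2) (Fin 2) F) * C = k • (1 : Matrix (Fin 2) (Fin 2) F) := by
    have : cls hF C 1 * cls hF C 1 = cls hF (C * C) 1 := by rw [cls_mul]; simp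
    rw [show 4 = 2 * 2 from rfl, pow_mul, hsq, sq, this, ← cls_one, cls_eq_iff]
    simp
  have hdet := det_coe_ne_zero C
  constructor
  · intro h
    -- If the square of `C` is scalar and its trace non-zero, `C ^ 2 = (tr C) C - det C` makes `C`
    -- itself scalar.
    have e4 := h4.1 (h ▸ pow_orderOf_eq_one _)
    have e2 : ¬ _ := fun h' => by
      have := Nat.le_of_dvd two_pos (orderOf_dvd_of_pow_eq_one (h2.2 h'))
      omega
    obtain ⟨k, hk, e⟩ := e4
    by_contra htr
    refine e2 ?_
    rw [← Matrix.ext_iff] at e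
    simp only [Matrix.mul_apply, Fin.sum_univ_two, Fin.forall_fin_two, Matrix.smul_apply,
      Matrix.one_apply, Matrix.trace_fin_two, smul_eq_mul, Fin.isValue, if_true, one_ne_zero,
      zero_ne_one, if_false, mul_one, mul_zero] at e htr
    obtain ⟨⟨e00, e01⟩, e10, e11⟩ := e
    set M : Matrix (Fin 2) (Fin 2) F := C.val
    have z01 : M 0 1 = 0 := by
      refine (mul_eq_zero.1 (?_ : (M 0 0 + M 1 1) * M 0 1 = 0)).resolve_left htr
      linear_combination e01
    have z10 : M 1 0 = 0 := by
      refine (mul_eq_zero.1 (?_ : (M 0 0 + M 1 1) * M 1 0 = 0)).resolve_left htr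
      linear_combination e10
    have zz : M 0 0 = M 1 1 := by
      refine sub_eq_zero.1 ((mul_eq_zero.1
        (?_ : (M 0 0 + M 1 1) * (M 0 0 - M 1 1) = 0)).resolve_left htr)
      linear_combination e00 - e11
    refine ⟨M 0 0, ?_, ?_⟩
    · intro h0
      rw [Matrix.det_fin_two, h0, z01] at hdet
      simp at hdet
    · ext a b
      fin_cases a <;> fin_cases b <;> simp [z01, z10, zz]
  · intro htr
    set M : Matrix (Fin 2) (Fin 2) F := C.val
    rw [Matrix.trace_fin_two] at htr
    rw [Matrix.det_fin_two] at hdet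
    have h1 : M 1 1 = - M 0 0 := by linear_combination htr
    rw [show 4 = 2 ^ (1 + 1) from rfl]
    have := Fact.mk Nat.prime_two
    refine orderOf_eq_prime_pow (fun h => ?_) (h4.2 ⟨-(M 0 0 * M 1 1 - M 0 1 * M 1 0),
      neg_ne_zero.2 hdet, ?_⟩)
    · rw [pow_one] at h
      obtain ⟨k, hk, e⟩ := h2.1 h
      rw [e] at h1
      simp only [Matrix.smul_apply, Matrix.one_apply, if_true, smul_eq_mul, mul_one] at h1
      exact hk (eq_zero_of_eq_neg hodd hF h1)
    · ext a b
      fin_cases a <;> fin_cases b <;>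
        simp [Matrix.mul_apply, Fin.sum_univ_two, h1] <;> ring

end Quotient

/-! ### Monomial classes -/

section Monomial

theorem map_mul_map {F : Type*} [Field F] {σ : F ≃+* F} (A B : Matrix (Fin 2) (Fin 2) F) :
    (A * B).map σ = A.map σ * B.map σ := Matrix.map_mul

variable {F : Type*} [Field F]

/-- The monomial matrices with an entry `1` in the last row: `dia(u, 1)` and, if `s` is true,
`off(u, 1)`. Up to scalars these are all the monomial matrices. -/
def mono (u : Fˣ) (s : Bool) : Matrix (Fin 2) (Fin 2) F :=
  if s then !![0, (u : F); 1, 0] else !![(u : F), 0; 0, 1]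

theorem det_mono_ne_zero (u : Fˣ) (s : Bool) : (mono u s).det ≠ 0 := by
  cases s <;> simp [mono, Matrix.det_fin_two]

/-- `mono u s` as an element of `GL(2, F)`. -/
noncomputable def monoGL (u : Fˣ) (s : Bool) : GL (Fin 2) F :=
  Matrix.GeneralLinearGroup.mkOfDetNeZero (mono u s) (det_mono_ne_zero u s)

theorem coe_monoGL (u : Fˣ) (s : Bool) : (monoGL u s : Matrix (Fin 2) (Fin 2) F) = mono u s := rfl

variable [Finite F] {q : ℕ}

/-- The stabilizer in `Ḡ` of the pair `{0, ∞}` of points of the projective line, listed by the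
classes of its monomial matrices. -/
noncomputable def monomialSet (hF : Nat.card F = q ^ 2) : Set (ConjAct (GBar hF)) :=
  Set.range fun p : Fˣ × Bool × Z2 => ConjAct.toConjAct (cls hF (monoGL p.1 p.2.1) p.2.2)

theorem ncard_monomialSet (hF : Nat.card F = q ^ 2) :
    (monomialSet hF).ncard = 4 * (q ^ 2 - 1) := by
  have hinj : Function.Injective fun p : Fˣ × Bool × Z2 =>
      ConjAct.toConjAct (cls hF (monoGL p.1 p.2.1) p.2.2) := by
    rintro ⟨u, s, i⟩ ⟨v, t, j⟩ h
    obtain ⟨rfl, k, hk, h⟩ := (cls_eq_iff hF _ _ _ _).1 (ConjAct.toConjAct.injective h)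
    rw [coe_monoGL, coe_monoGL] at h
    have e := Matrix.ext_iff.2 h
    cases s <;> cases t <;> simp [mono, Fin.forall_fin_two] at e
    · obtain ⟨e, rfl⟩ := e
      simpa [Units.ext_iff] using e
    · obtain ⟨e, rfl⟩ := e
      simpa [Units.ext_iff] using e
  rw [monomialSet, Set.ncard_range_of_injective hinj, Nat.card_prod, Nat.card_prod,
    Nat.card_units, hF]
  simp only [Nat.card_eq_fintype_card, Fintype.card_bool, Fintype.card_multiplicative, ZMod.card]
  ring

/-- A matrix conjugating, up to a scalar, one diagonal matrix with distinct entries to another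
is monomial. -/
theorem mem_monomialSet (hF : Nat.card F = q ^ 2) (P : GL (Fin 2) F) (i : Z2)
    {x y x' y' k : F} (hxy : x ≠ y) (hxy' : x' ≠ y') (hk : k ≠ 0)
    (h : (P : Matrix (Fin 2) (Fin 2) F) * !![x, 0; 0, y]
      = k • (!![x', 0; 0, y'] * (P : Matrix (Fin 2) (Fin 2) F))) :
    ConjAct.toConjAct (cls hF P i) ∈ monomialSet hF := by
  have hdet := det_coe_ne_zero P
  rw [← Matrix.ext_iff] at h
  rw [Matrix.det_fin_two] at hdet
  simp only [Matrix.mul_apply, Fin.sum_univ_two, Fin.forall_fin_two, Matrix.smul_apply,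
    Matrix.of_apply, Matrix.cons_val', Matrix.cons_val_zero, Matrix.cons_val_one,
    Matrix.cons_val_fin_one, smul_eq_mul, mul_zero, zero_mul, add_zero, zero_add] at h
  obtain ⟨⟨h00, h01⟩, h10, h11⟩ := h
  set p := P.val 0 0 with hp
  set r := P.val 0 1 with hr
  set s := P.val 1 0 with hs
  set t := P.val 1 1 with ht
  have col {a b w : F} (h1 : a * x = k * (w * a)) (h2 : b * y = k * (w * b)) (ha : a ≠ 0) :
      b = 0 := by
    by_contra hb
    have e1 : x = k * w := mul_right_cancel₀ ha (by linear_combination h1)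
    have e2 : y = k * w := mul_right_cancel₀ hb (by linear_combination h2)
    exact hxy (e1.trans e2.symm)
  have row {a b w : F} (h1 : a * w = k * (x' * a)) (h2 : b * w = k * (y' * b)) (ha : a ≠ 0) :
      b = 0 := by
    by_contra hb
    have e1 : w = k * x' := mul_right_cancel₀ ha (by linear_combination h1)
    have e2 : w = k * y' := mul_right_cancel₀ hb (by linear_combination h2)
    exact hxy' (mul_left_cancel₀ hk (e1.symm.trans e2))
  by_cases p0 : p = 0
  · have r0 : r ≠ 0 := by
      intro h
      simp [p0, h] at hdet
    have s0 : s ≠ 0 := by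
      intro h
      simp [p0, h] at hdet
    have t0 : t = 0 := row h01 h11 r0
    refine ⟨(Units.mk0 (r / s) (div_ne_zero r0 s0), true, i), ?_⟩
    refine congrArg _ ((cls_eq_iff hF _ _ _ _).2 ⟨rfl, s⁻¹, inv_ne_zero s0, ?_⟩)
    rw [coe_monoGL]
    ext a b
    fin_cases a <;> fin_cases b <;>
      simp [mono, ← hp, ← hr, ← hs, ← ht, p0, t0, s0, div_eq_inv_mul]
  · have r0 : r = 0 := col h00 h01 p0
    have s0 : s = 0 := row h00 h10 p0
    have t0 : t ≠ 0 := by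
      intro h
      simp [r0, h] at hdet
    refine ⟨(Units.mk0 (p / t) (div_ne_zero p0 t0), false, i), ?_⟩
    refine congrArg _ ((cls_eq_iff hF _ _ _ _).2 ⟨rfl, t⁻¹, inv_ne_zero t0, ?_⟩)
    rw [coe_monoGL]
    ext a b
    fin_cases a <;> fin_cases b <;>
      simp [mono, ← hp, ← hr, ← hs, ← ht, r0, s0, t0, div_eq_inv_mul]

/-- The square of `[B, 1]` is represented by a diagonal, non-scalar matrix in both forms: a scalar
matrix would force a non-square `l` to have norm `1` or to lie in `GF(q)`. -/
theorem exists_sq_eq_diagonal (hodd : Odd q) (hF : Nat.card F = q ^ 2)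
    {A B : Matrix (Fin 2) (Fin 2) F} (h : DiagonalForm hF A B ∨ OffDiagonalForm hF A B) :
    ∃ x y : F, x ≠ y ∧ B * B.map (sigma hF) = !![x, 0; 0, y] := by
  rcases h with ⟨l, b, c, hl, -, rfl, -⟩ | ⟨l, a, d, hl, -, rfl, -⟩
  · refine ⟨l * sigma hF l, 1, fun h => hl ?_, ?_⟩
    · exact isSquare_of_norm_eq_sq hodd hF one_ne_zero (map_one _) (by rw [h, one_pow])
    · ext a b
      fin_cases a <;> fin_cases b <;> simp [Matrix.mul_apply, Fin.sum_univ_two]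
  · refine ⟨l, sigma hF l, fun h => hl (isSquare_of_sigma_eq hodd hF h.symm), ?_⟩
    ext a b
    fin_cases a <;> fin_cases b <;> simp [Matrix.mul_apply, Fin.sum_univ_two]

theorem val_fst_smul (hF : Nat.card F = q ^ 2) (g : ConjAct (GBar hF)) (z : M hF × M hF) :
    ((g • z).1 : GBar hF) = ConjAct.ofConjAct g * z.1 * (ConjAct.ofConjAct g)⁻¹ := rfl

theorem val_snd_smul (hF : Nat.card F = q ^ 2) (g : ConjAct (GBar hF)) (z : M hF × M hF) :
    ((g • z).2 : GBar hF) = ConjAct.ofConjAct g * z.2 * (ConjAct.ofConjAct g)⁻¹ := rfl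

/-- If `P` conjugates one non-singular pair into another, it conjugates the squares of their
second members, which are diagonal. -/
theorem mem_monomialSet_of_smul (hodd : Odd q) (hF : Nat.card F = q ^ 2) {z : M hF × M hF}
    (hz : NonSingular hF z) (g : ConjAct (GBar hF)) (hgz : NonSingular hF (g • z)) :
    g ∈ monomialSet hF := by
  obtain ⟨A, B, -, hB, -, hform⟩ := hz
  obtain ⟨A', B', -, hB', -, hform'⟩ := hgz
  obtain ⟨x, y, hxy, hd⟩ := exists_sq_eq_diagonal hodd hF (hform.imp And.left And.left)
  obtain ⟨x', y', hxy', hd'⟩ := exists_sq_eq_diagonal hodd hF (hform'.imp And.left And.left)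
  obtain ⟨P, i, hP⟩ := exists_cls hF (ConjAct.ofConjAct g)
  obtain rfl : g = ConjAct.toConjAct (cls hF P i) := by rw [← hP, ConjAct.toConjAct_ofConjAct]
  rw [val_snd_smul, hB, mul_inv_eq_iff_eq_mul, ConjAct.ofConjAct_toConjAct, cls_mul_eq_iff] at hB'
  obtain ⟨k, hk, h⟩ := hB'
  have hτ : (B.val.map (tau hF i)).map (sigma hF) = (B.val.map (sigma hF)).map (tau hF i) := by
    ext a b
    simp [sigma_tau]
  have hτd : (!![x, 0; 0, y] : Matrix (Fin 2) (Fin 2) F).map (tau hF i)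
      = !![tau hF i x, 0; 0, tau hF i y] := by
    ext a b
    fin_cases a <;> fin_cases b <;> simp
  have hσσ : (P.val.map (sigma hF)).map (sigma hF) = P.val := by
    ext a b
    simp
  have hsm (N : Matrix (Fin 2) (Fin 2) F) :
      (k • N).map (sigma hF) = sigma hF k • N.map (sigma hF) := by
    ext a b
    simp
  refine mem_monomialSet hF P i ((tau hF i).injective.ne hxy) hxy'
    (mul_ne_zero hk ((map_ne_zero (sigma hF)).2 hk)) ?_
  -- Multiplying `P B ^ τ = k B' P ^ σ` by its image under `σ` gives the relation for the squares.
  calc P.val * !![tau hF i x, 0; 0, tau hF i y]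
      = P.val * B.val.map (tau hF i) * (B.val.map (sigma hF)).map (tau hF i) := by
        rw [← hτd, ← hd, map_mul_map, Matrix.mul_assoc]
    _ = k • (B'.val * (P.val * B.val.map (tau hF i)).map (sigma hF)) := by
        rw [map_mul_map, hτ, h, Matrix.smul_mul, Matrix.mul_assoc]
    _ = (k * sigma hF k) • (!![x', 0; 0, y'] * P.val) := by
        rw [h, hsm, map_mul_map, hσσ, ← hd', Matrix.mul_smul, smul_smul, Matrix.mul_assoc]

end Monomial

/-! ### Triviality of stabilizers -/

section Freeness

theorem map_fin_two {α β : Type*} (f : α → β) (a b c d : α) :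
    (!![a, b; c, d] : Matrix (Fin 2) (Fin 2) α).map f = !![f a, f b; f c, f d] := by
  ext i j
  fin_cases i <;> fin_cases j <;> rfl

variable {F : Type*} [Field F]

/-- The entrywise form of the relation `P M ^ τ = k M' P ^ σ` for `P = dia(u, 1)`. -/
theorem mono_false_mul_eq_iff {σ τ : F ≃+* F} (u : Fˣ) (k a b c d a' b' c' d' : F) :
    mono u false * (!![a, b; c, d] : Matrix (Fin 2) (Fin 2) F).map τ
      = k • (!![a', b'; c', d'] * (mono u false).map σ) ↔
    u * τ a = k * (a' * σ u) ∧ u * τ b = k * b' ∧ τ c = k * (c' * σ u) ∧ τ d = k * d' := by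
  rw [← Matrix.ext_iff]
  simp [mono, map_fin_two, Fin.forall_fin_two, and_assoc]

/-- The entrywise form of the relation `P M ^ τ = k M' P ^ σ` for `P = off(u, 1)`. -/
theorem mono_true_mul_eq_iff {σ τ : F ≃+* F} (u : Fˣ) (k a b c d a' b' c' d' : F) :
    mono u true * (!![a, b; c, d] : Matrix (Fin 2) (Fin 2) F).map τ
      = k • (!![a', b'; c', d'] * (mono u true).map σ) ↔
    u * τ c = k * b' ∧ u * τ d = k * (a' * σ u) ∧ τ a = k * d' ∧ τ b = k * (c' * σ u) := by
  rw [← Matrix.ext_iff]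
  simp [mono, map_fin_two, Fin.forall_fin_two, and_assoc]

variable [Finite F] {q : ℕ}

theorem trace_sq_diagonalB (hF : Nat.card F = q ^ 2) (l : F) :
    (!![l, 0; 0, 1] * (!![l, 0; 0, 1] : Matrix (Fin 2) (Fin 2) F).map (sigma hF)).trace
      = l * sigma hF l + 1 := by
  rw [map_fin_two, Matrix.mul_fin_two, Matrix.trace_fin_two_of]
  simp

theorem trace_sq_diagonalA (hF : Nat.card F = q ^ 2) (l b c : F) :
    (!![-1, b; c, sigma hF l] *
      (!![-1, b; c, sigma hF l] : Matrix (Fin 2) (Fin 2) F).map (sigma hF)).trace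
      = l * sigma hF l + 1 + (b * sigma hF c + sigma hF b * c) := by
  rw [map_fin_two, Matrix.mul_fin_two, Matrix.trace_fin_two_of]
  simp
  ring

theorem trace_sq_offDiagonalB (hF : Nat.card F = q ^ 2) (l : F) :
    (!![0, l; 1, 0] * (!![0, l; 1, 0] : Matrix (Fin 2) (Fin 2) F).map (sigma hF)).trace
      = l + sigma hF l := by
  rw [map_fin_two, Matrix.mul_fin_two, Matrix.trace_fin_two_of]
  simp

theorem trace_sq_offDiagonalA (hF : Nat.card F = q ^ 2) (l a d : F) :
    (!![a, sigma hF l; -1, d] *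
      (!![a, sigma hF l; -1, d] : Matrix (Fin 2) (Fin 2) F).map (sigma hF)).trace
      = a * sigma hF a + d * sigma hF d - (l + sigma hF l) := by
  rw [map_fin_two, Matrix.mul_fin_two, Matrix.trace_fin_two_of]
  simp
  ring

theorem norm_eq_neg_one (hodd : Odd q) (hF : Nat.card F = q ^ 2) {l : F} (hl : ¬ IsSquare l)
    (h : (l * sigma hF l) * (l * sigma hF l) = 1) : l * sigma hF l = -1 :=
  (mul_self_eq_one_iff.1 h).resolve_left fun h1 =>
    hl (isSquare_of_norm_eq_sq hodd hF one_ne_zero (map_one _) (by rw [h1, one_pow]))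

/-- A monomial class that fixes a pair of the diagonal form is trivial. The class of `off(u, 1)`
may fix a pair both of whose members have order four, and these are excluded. -/
theorem diagonal_stabilizer (hodd : Odd q) (hF : Nat.card F = q ^ 2) {l b c : F}
    (hl : ¬ IsSquare l) (hb : b ≠ 0) (hc : c ≠ 0)
    (h4 : ¬ (l * sigma hF l + 1 = 0 ∧ b * sigma hF c + sigma hF b * c = 0))
    (u : Fˣ) (s : Bool) (i : Z2)
    (hB : ∃ k : F, k ≠ 0 ∧ mono u s * (!![l, 0; 0, 1] : Matrix (Fin 2) (Fin 2) F).map (tau hF i)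
      = k • (!![l, 0; 0, 1] * (mono u s).map (sigma hF)))
    (hA : ∃ k : F, k ≠ 0 ∧
      mono u s * (!![-1, b; c, sigma hF l] : Matrix (Fin 2) (Fin 2) F).map (tau hF i)
      = k • (!![-1, b; c, sigma hF l] * (mono u s).map (sigma hF))) :
    (u : F) = 1 ∧ s = false ∧ i = 1 := by
  obtain ⟨k, -, hB⟩ := hB
  obtain ⟨k', -, hA⟩ := hA
  have hl0 := ne_zero_of_not_isSquare hl
  have hu0 : (u : F) ≠ 0 := u.ne_zero
  have hσl0 : sigma hF l ≠ 0 := (map_ne_zero _).2 hl0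
  have hσu0 : sigma hF u ≠ 0 := (map_ne_zero _).2 hu0
  have conj {x y : F} (h : x = y) : sigma hF x = sigma hF y := congrArg _ h
  rcases eq_one_or_gen i with rfl | rfl <;> cases s <;>
    simp only [mono_false_mul_eq_iff, mono_true_mul_eq_iff, tau_one, tau_gen, map_neg, map_one,
      sigma_sigma, map_zero] at hA hB <;>
    obtain ⟨hB1, hB2, hB3, hB4⟩ := hB <;> obtain ⟨hA1, hA2, hA3, hA4⟩ := hA
  -- `P = dia(u, 1)`, without `σ`: the corner entry forces `k' = 1`, and `b ≠ 0` forces `u = 1`.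
  · have hk' : k' = 1 := mul_right_cancel₀ hσl0 (by rw [← hA4, one_mul])
    rw [hk', one_mul] at hA2
    exact ⟨mul_right_cancel₀ hb (hA2.trans (one_mul b).symm), rfl, rfl⟩
  -- `P = off(u, 1)`, without `σ`: `l` has norm `-1` and both members have order four.
  · refine absurd ?_ h4
    have hu : (u : F) = l * l * sigma hF u := by
      linear_combination hB2 - l * sigma hF u * hB3
    have hN : l * sigma hF l = -1 := by
      refine norm_eq_neg_one hodd hF hl (mul_right_cancel₀ hσu0 ?_)
      linear_combination -sigma hF l ^ 2 * hu + sigma hF l * hA2 + sigma hF u * hA3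
    have hbc : b = -(sigma hF l * u * c) := by
      linear_combination sigma hF l * hA1 - b * hA3
    have hbc' := conj hbc
    rw [map_neg, map_mul, map_mul, sigma_sigma] at hbc'
    refine ⟨by rw [hN, neg_add_cancel], ?_⟩
    rw [hbc']
    linear_combination sigma hF c * hbc -
      c * sigma hF c * (sigma hF l * hu + l * sigma hF u * hN)
  -- `P = dia(u, 1)`, with `σ`: the norm of `l` would be the square of an element of `GF(q)`.
  · exfalso
    have hk' : k' * sigma hF k' = 1 := by
      refine mul_right_cancel₀ hl0 ?_
      have h := conj hA4
      rw [map_mul, sigma_sigma] at h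
      linear_combination -hA4 - k' * h
    have hu : (u : F) * sigma hF u = 1 := by
      refine mul_right_cancel₀ hb ?_
      have h := conj hA2
      rw [map_mul, map_mul, sigma_sigma] at h
      linear_combination u * h + sigma hF k' * hA2 + b * hk'
    have hul : u * sigma hF l = l * sigma hF u := by
      linear_combination hB1 - l * sigma hF u * hB4
    -- `l / u` lies in `GF(q)` and its square is the norm of `l`.
    refine hl (isSquare_of_norm_eq_sq hodd hF (r := l / u) (div_ne_zero hl0 hu0) ?_ ?_)
    · rw [map_div₀, div_eq_div_iff hσu0 hu0]
      linear_combination hul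
    · rw [div_pow, eq_div_iff (pow_ne_zero 2 hu0)]
      linear_combination l * u * hul + l ^ 2 * hu
  -- `P = off(u, 1)`, with `σ`: `l` has norm `-1`, and `c` would equal `-c`.
  · exfalso
    have hu : (u : F) = sigma hF l * l * sigma hF u := by
      linear_combination hB2 - l * sigma hF u * hB3
    have hN : l * sigma hF l = -1 := by
      refine norm_eq_neg_one hodd hF hl (mul_right_cancel₀ hσu0 ?_)
      linear_combination -(l * sigma hF l) * hu + sigma hF l * hA2 + sigma hF u * hA3
    have hbc : b = -(sigma hF l * u * sigma hF c) := by
      linear_combination sigma hF l * hA1 - b * hA3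
    have hbc' := conj hbc
    rw [map_neg, map_mul, map_mul, sigma_sigma, sigma_sigma] at hbc'
    refine mul_ne_zero hσu0 hc (eq_zero_of_eq_neg hodd hF ?_)
    linear_combination sigma hF l * hA4 - c * sigma hF u * hA3 - sigma hF l * hbc' +
      sigma hF u * c * hN

/-- A monomial class that fixes a pair of the off-diagonal form is trivial. The class of
`off(u, 1)` may fix a pair both of whose members have order four, and these are excluded. -/
theorem offDiagonal_stabilizer (hodd : Odd q) (hF : Nat.card F = q ^ 2) {l a d : F}
    (hl : ¬ IsSquare l) (had : ¬ (a = 0 ∧ d = 0))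
    (h4 : ¬ (l + sigma hF l = 0 ∧ a * sigma hF a + d * sigma hF d = 0))
    (u : Fˣ) (s : Bool) (i : Z2)
    (hB : ∃ k : F, k ≠ 0 ∧ mono u s * (!![0, l; 1, 0] : Matrix (Fin 2) (Fin 2) F).map (tau hF i)
      = k • (!![0, l; 1, 0] * (mono u s).map (sigma hF)))
    (hA : ∃ k : F, k ≠ 0 ∧
      mono u s * (!![a, sigma hF l; -1, d] : Matrix (Fin 2) (Fin 2) F).map (tau hF i)
      = k • (!![a, sigma hF l; -1, d] * (mono u s).map (sigma hF))) :
    (u : F) = 1 ∧ s = false ∧ i = 1 := by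
  obtain ⟨k, -, hB⟩ := hB
  obtain ⟨k', -, hA⟩ := hA
  have hl0 := ne_zero_of_not_isSquare hl
  have hu0 : (u : F) ≠ 0 := u.ne_zero
  have hσl0 : sigma hF l ≠ 0 := (map_ne_zero _).2 hl0
  have hσu0 : sigma hF u ≠ 0 := (map_ne_zero _).2 hu0
  have conj {x y : F} (h : x = y) : sigma hF x = sigma hF y := congrArg _ h
  have hl1 : sigma hF l ≠ l := fun h => hl (isSquare_of_sigma_eq hodd hF h)
  rcases eq_one_or_gen i with rfl | rfl <;> cases s <;>
    simp only [mono_false_mul_eq_iff, mono_true_mul_eq_iff, tau_one, tau_gen, map_neg, map_one,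
      sigma_sigma, map_zero] at hA hB <;>
    obtain ⟨hB1, hB2, hB3, hB4⟩ := hB <;> obtain ⟨hA1, hA2, hA3, hA4⟩ := hA
  -- `P = dia(u, 1)`, without `σ`: `u` has norm `1`, and one of `a`, `d` is non-zero.
  · refine ⟨?_, rfl, rfl⟩
    have hk' : k' = u := mul_right_cancel₀ hσl0 hA2.symm
    subst hk'
    by_cases hd : d = 0
    · have ha : a ≠ 0 := fun ha => had ⟨ha, hd⟩
      have hu1 : sigma hF u = 1 := by
        refine mul_left_cancel₀ (mul_ne_zero hu0 ha) ?_
        linear_combination -hA1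
      rw [hu1] at hA3
      linear_combination hA3
    · exact mul_right_cancel₀ hd (by rw [← hA4, one_mul])
  -- `P = off(u, 1)`, without `σ`: `l` has trace zero and both members have order four.
  · refine absurd ?_ h4
    have hsq : l * l = u * sigma hF u := by linear_combination l * hB4 - sigma hF u * hB1
    have hsq' := conj hsq
    rw [map_mul, map_mul, sigma_sigma] at hsq'
    have hl2 : sigma hF l = -l := by
      refine (mul_self_eq_mul_self_iff.1 ?_).resolve_left hl1
      linear_combination hsq' - hsq
    have hk' := conj hA1
    rw [map_mul, map_mul, map_neg, map_one, sigma_sigma] at hk'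
    have hkk : k' * sigma hF k' = -1 := by
      refine mul_right_cancel₀ (mul_ne_zero hl0 hl0) ?_
      linear_combination -(k' * l) * hk' - sigma hF u * (hA1 + k' * hl2) + hsq
    have ha := conj hA3
    rw [map_mul] at ha
    refine ⟨by rw [hl2, add_neg_cancel], ?_⟩
    rw [ha]
    linear_combination sigma hF k' * sigma hF d * hA3 + d * sigma hF d * hkk
  -- `P = dia(u, 1)`, with `σ`: `u` has norm `-1`, and `a`, `d` would equal `-a`, `-d`.
  · exfalso
    have hul : u * sigma hF u * sigma hF l = l := by
      linear_combination sigma hF u * hB2 - l * hB3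
    have hul' := conj hul
    rw [map_mul, map_mul, sigma_sigma, sigma_sigma] at hul'
    have hu : u * sigma hF u = -1 := by
      have h1 : (u * sigma hF u) * (u * sigma hF u) = 1 := by
        refine mul_right_cancel₀ hl0 ?_
        linear_combination u * sigma hF u * hul' + hul
      refine (mul_self_eq_one_iff.1 h1).resolve_left fun h => hl1 ?_
      rw [← hul, h, one_mul, sigma_sigma, ← hul', mul_comm (sigma hF (u : F)), h, one_mul]
    have ha : u * sigma hF a = a := by linear_combination hA1 + a * hA3
    have hd : sigma hF u * sigma hF d = d := by linear_combination sigma hF u * hA4 + d * hA3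
    have ha' := conj ha
    have hd' := conj hd
    rw [map_mul, sigma_sigma] at ha'
    rw [map_mul, sigma_sigma, sigma_sigma] at hd'
    refine had ⟨eq_zero_of_eq_neg hodd hF ?_, eq_zero_of_eq_neg hodd hF ?_⟩
    · linear_combination -ha - u * ha' + a * hu
    · linear_combination -hd - sigma hF u * hd' + d * hu
  -- `P = off(u, 1)`, with `σ`: `u` lies in `GF(q)`, and the norm of `l` would be `u ^ 2`.
  · exfalso
    have hlu : l * sigma hF l = u * sigma hF u := by
      linear_combination l * hB4 - sigma hF u * hB1
    have ha := conj hA3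
    rw [map_mul, sigma_sigma] at ha
    have hd : d ≠ 0 := by
      rintro rfl
      exact had ⟨by rw [ha, map_zero, mul_zero], rfl⟩
    have hd' : sigma hF d ≠ 0 := (map_ne_zero _).2 hd
    have hk := conj hA1
    rw [map_mul, map_mul, map_neg, map_one, sigma_sigma] at hk
    have hkk : k' * sigma hF k' = 1 := by
      refine mul_right_cancel₀ (mul_ne_zero hl0 hσl0) ?_
      linear_combination -(k' * sigma hF l) * hk + sigma hF u * hA1 - hlu
    have huu : sigma hF u = u := by
      refine mul_right_cancel₀ hd' ?_
      linear_combination -hA2 - k' * sigma hF u * ha - sigma hF u * sigma hF d * hkk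
    exact hl (isSquare_of_norm_eq_sq hodd hF hu0 huu (by rw [hlu, huu, sq]))

end Freeness

/-! ### The monomial classes acting on non-singular pairs -/

section MonomialAction

variable {F : Type*} [Field F] [Finite F] {q : ℕ}

theorem orderOf_smul {G α : Type*} [Group G] [Monoid α] [MulDistribMulAction G α] (g : G) (x : α) :
    orderOf (g • x) = orderOf x :=
  orderOf_injective (MulDistribMulAction.toMonoidHom α g) (MulAction.injective g) x

theorem not_order_four_iff (hodd : Odd q) (hF : Nat.card F = q ^ 2) (z : M hF × M hF)
    (A B : GL (Fin 2) F) (hA : (z.1 : GBar hF) = cls hF A Z2.one)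
    (hB : (z.2 : GBar hF) = cls hF B Z2.one) :
    ¬ (orderOf z.1 = 4 ∧ orderOf z.2 = 4) ↔
      ¬ ((A.val * A.val.map (sigma hF)).trace = 0 ∧ (B.val * B.val.map (sigma hF)).trace = 0) := by
  rw [← Subgroup.orderOf_coe, ← Subgroup.orderOf_coe, hA, hB, orderOf_cls_eq_four_iff hodd,
    orderOf_cls_eq_four_iff hodd]

theorem det_ne_zero_of_form (hodd : Odd q) (hF : Nat.card F = q ^ 2)
    {A B : Matrix (Fin 2) (Fin 2) F} (h : DiagonalForm hF A B ∨ OffDiagonalForm hF A B) :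
    ¬ IsSquare A.det ∧ ¬ IsSquare B.det := by
  rcases h with ⟨l, b, c, hl, hμ, rfl, rfl⟩ | ⟨l, a, d, hl, hμ, rfl, rfl⟩ <;>
    simp only [Matrix.det_fin_two_of]
  · constructor
    · rwa [← isSquare_neg_iff hodd hF, show -(-1 * sigma hF l - b * c) = b * c + sigma hF l by ring]
    · simpa using hl
  · constructor
    · rwa [show a * d - sigma hF l * -1 = a * d + sigma hF l by ring]
    · rwa [← isSquare_neg_iff hodd hF, show -((0 : F) * 0 - l * 1) = l by ring]

/-- Transport of non-singularity along a conjugation: the matrices `A'` and `B'` need only be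
verified to represent the conjugated pair and to have one of the two forms. -/
theorem nonSingular_smul (hodd : Odd q) (hF : Nat.card F = q ^ 2) {z : M hF × M hF}
    {A B P : GL (Fin 2) F} (hA : (z.1 : GBar hF) = cls hF A Z2.one)
    (hB : (z.2 : GBar hF) = cls hF B Z2.one)
    (h4 : ¬ (orderOf z.1 = 4 ∧ orderOf z.2 = 4)) (i : Z2) (A' B' : Matrix (Fin 2) (Fin 2) F)
    (hAA : ∃ k : F, k ≠ 0 ∧ P.val * A.val.map (tau hF i) = k • (A' * P.val.map (sigma hF)))
    (hBB : ∃ k : F, k ≠ 0 ∧ P.val * B.val.map (tau hF i) = k • (B' * P.val.map (sigma hF)))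
    (hform : (DiagonalForm hF A' B' ∧ ¬ (A' 1 0 = 0 ∨ A' 0 1 = 0)) ∨
      (OffDiagonalForm hF A' B' ∧ ¬ (A' 0 0 = 0 ∧ A' 1 1 = 0))) :
    NonSingular hF (ConjAct.toConjAct (cls hF P i) • z) := by
  have hdet := det_ne_zero_of_form hodd hF (hform.imp And.left And.left)
  refine ⟨Matrix.GeneralLinearGroup.mkOfDetNeZero A' (ne_zero_of_not_isSquare hdet.1),
    Matrix.GeneralLinearGroup.mkOfDetNeZero B' (ne_zero_of_not_isSquare hdet.2), ?_, ?_, ?_, hform⟩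
  · rw [val_fst_smul, hA, mul_inv_eq_iff_eq_mul, ConjAct.ofConjAct_toConjAct, cls_mul_eq_iff]
    exact hAA
  · rw [val_snd_smul, hB, mul_inv_eq_iff_eq_mul, ConjAct.ofConjAct_toConjAct, cls_mul_eq_iff]
    exact hBB
  · rwa [Prod.smul_fst, Prod.smul_snd, orderOf_smul, orderOf_smul]

/-- The new parameters are read off from the conjugated matrices after rescaling them to the
normalized form; `l` and `b c + l ^ σ` (or `a d + l ^ σ`) are inverted or fixed up to squares. -/
theorem nonSingular_smul_of_mem (hodd : Odd q) (hF : Nat.card F = q ^ 2) {z : M hF × M hF}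
    (hz : NonSingular hF z) {g : ConjAct (GBar hF)} (hg : g ∈ monomialSet hF) :
    NonSingular hF (g • z) := by
  obtain ⟨⟨u, s, i⟩, rfl⟩ := hg
  obtain ⟨A, B, hA, hB, h4, hform⟩ := hz
  have hu0 : (u : F) ≠ 0 := u.ne_zero
  have hσu0 : sigma hF u ≠ 0 := (map_ne_zero _).2 hu0
  have hsq := isSquare_sigma_mul_inv hodd hF (u : F)
  have hsq0 : sigma hF u * (u : F)⁻¹ ≠ 0 := mul_ne_zero hσu0 (inv_ne_zero hu0)
  have hsq' : IsSquare (u / sigma hF u) := by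
    rw [← inv_div, div_eq_mul_inv]
    exact hsq.inv
  have hsq0' : u / sigma hF u ≠ 0 := div_ne_zero hu0 hσu0
  have hN := isSquare_norm hodd hF (u : F)
  have hN0 : u * sigma hF u ≠ 0 := mul_ne_zero hu0 hσu0
  rcases hform with ⟨⟨l, b, c, hl, hμ, eB, eA⟩, hne⟩ | ⟨⟨l, a, d, hl, hμ, eB, eA⟩, hne⟩
  · rw [eA] at hne
    simp only [Matrix.of_apply, Matrix.cons_val', Matrix.cons_val_zero, Matrix.cons_val_one,
      Matrix.cons_val_fin_one, not_or] at hne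
    obtain ⟨hc, hb⟩ := hne
    set τ := tau hF i with hτ
    have hl' : ¬ IsSquare (τ l) := by rwa [isSquare_map_iff]
    have hμ' : ¬ IsSquare (τ b * τ c + sigma hF (τ l)) := by
      rwa [hτ, sigma_tau, ← map_mul, ← map_add, isSquare_map_iff]
    have hb' : τ b ≠ 0 := (map_ne_zero _).2 hb
    have hc' : τ c ≠ 0 := (map_ne_zero _).2 hc
    have hl0 := ne_zero_of_not_isSquare hl'
    have hσl0 : sigma hF (τ l) ≠ 0 := (map_ne_zero _).2 hl0
    have hστ : τ (sigma hF l) = sigma hF (τ l) := (sigma_tau hF i l).symm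
    cases s
    · refine nonSingular_smul hodd hF hA hB h4 i
        !![-1, sigma hF u * τ b; τ c / u, sigma hF (u / sigma hF u * τ l)]
        !![u / sigma hF u * τ l, 0; 0, 1] ⟨u / sigma hF u, div_ne_zero hu0 hσu0, ?_⟩
        ⟨1, one_ne_zero, ?_⟩ (Or.inl ⟨⟨_, _, _, ?_, ?_, rfl, rfl⟩, ?_⟩)
      · rw [eA, coe_monoGL, mono_false_mul_eq_iff, ← hτ, hστ]
        simp only [map_neg, map_one, map_mul, map_div₀, sigma_sigma]
        refine ⟨?_, ?_, ?_, ?_⟩ <;> field_simp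
      · rw [eB, coe_monoGL, mono_false_mul_eq_iff, ← hτ]
        simp only [map_one, map_zero, mul_zero, zero_mul, true_and]
        refine ⟨?_, ?_⟩ <;> field_simp
      · exact not_isSquare_mul hsq' hsq0' hl'
      · have := not_isSquare_mul hsq hsq0 hμ'
        convert this using 2
        simp only [map_mul, map_div₀, sigma_sigma]
        field_simp
      · simp [hu0, hb', hc']
    · refine nonSingular_smul hodd hF hA hB h4 i
        !![-1, -(sigma hF u * τ c / sigma hF (τ l)); -(τ b / (u * sigma hF (τ l))),
          sigma hF (u / sigma hF u * (τ l)⁻¹)]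
        !![u / sigma hF u * (τ l)⁻¹, 0; 0, 1]
        ⟨-(sigma hF (τ l) * u / sigma hF u),
          neg_ne_zero.2 (div_ne_zero (mul_ne_zero hσl0 hu0) hσu0), ?_⟩
        ⟨τ l, hl0, ?_⟩ (Or.inl ⟨⟨_, _, _, ?_, ?_, rfl, rfl⟩, ?_⟩)
      · rw [eA, coe_monoGL, mono_true_mul_eq_iff, ← hτ, hστ]
        simp only [map_neg, map_one, map_mul, map_div₀, map_inv₀, sigma_sigma]
        refine ⟨?_, ?_, ?_, ?_⟩ <;> field_simp
      · rw [eB, coe_monoGL, mono_true_mul_eq_iff, ← hτ]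
        simp only [map_one, map_zero, mul_zero, zero_mul, and_true, true_and]
        refine ⟨?_, ?_⟩ <;> field_simp
      · exact not_isSquare_mul hsq' hsq0' (not_isSquare_inv hl')
      · have := not_isSquare_mul (hsq.mul (IsSquare.sq (sigma hF (τ l))⁻¹))
          (mul_ne_zero hsq0 (pow_ne_zero 2 (inv_ne_zero hσl0))) hμ'
        convert this using 2
        simp only [map_mul, map_div₀, map_inv₀, sigma_sigma]
        field_simp
      · simp [hu0, hb', hc', hl0]
  · rw [eA] at hne
    simp only [Matrix.of_apply, Matrix.cons_val', Matrix.cons_val_zero, Matrix.cons_val_one,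
      Matrix.cons_val_fin_one] at hne
    set τ := tau hF i with hτ
    have hl' : ¬ IsSquare (τ l) := by rwa [isSquare_map_iff]
    have hμ' : ¬ IsSquare (τ a * τ d + sigma hF (τ l)) := by
      rwa [hτ, sigma_tau, ← map_mul, ← map_add, isSquare_map_iff]
    have hl0 := ne_zero_of_not_isSquare hl'
    have hσl0 : sigma hF (τ l) ≠ 0 := (map_ne_zero _).2 hl0
    have hστ : τ (sigma hF l) = sigma hF (τ l) := (sigma_tau hF i l).symm
    cases s
    · refine nonSingular_smul hodd hF hA hB h4 i
        !![u * τ a, sigma hF (u * sigma hF u * τ l); -1, sigma hF u * τ d]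
        !![0, u * sigma hF u * τ l; 1, 0] ⟨(sigma hF u)⁻¹, inv_ne_zero hσu0, ?_⟩
        ⟨(sigma hF u)⁻¹, inv_ne_zero hσu0, ?_⟩ (Or.inr ⟨⟨_, _, _, ?_, ?_, rfl, rfl⟩, ?_⟩)
      · rw [eA, coe_monoGL, mono_false_mul_eq_iff, ← hτ, hστ]
        simp only [map_neg, map_one, map_mul, sigma_sigma]
        refine ⟨?_, ?_, ?_, ?_⟩ <;> field_simp
      · rw [eB, coe_monoGL, mono_false_mul_eq_iff, ← hτ]
        simp only [map_one, map_zero, mul_zero, zero_mul, and_true, true_and]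
        refine ⟨?_, ?_⟩ <;> field_simp
      · exact not_isSquare_mul hN hN0 hl'
      · have := not_isSquare_mul hN hN0 hμ'
        convert this using 2
        simp only [map_mul, sigma_sigma]
        ring
      · simpa [hu0] using hne
    · refine nonSingular_smul hodd hF hA hB h4 i
        !![-(u * τ d / sigma hF (τ l)), sigma hF (u * sigma hF u * (τ l)⁻¹); -1,
          -(sigma hF u * τ a / sigma hF (τ l))]
        !![0, u * sigma hF u * (τ l)⁻¹; 1, 0]
        ⟨-(sigma hF (τ l) / sigma hF u), neg_ne_zero.2 (div_ne_zero hσl0 hσu0), ?_⟩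
        ⟨τ l / sigma hF u, div_ne_zero hl0 hσu0, ?_⟩ (Or.inr ⟨⟨_, _, _, ?_, ?_, rfl, rfl⟩, ?_⟩)
      · rw [eA, coe_monoGL, mono_true_mul_eq_iff, ← hτ, hστ]
        simp only [map_neg, map_one, map_mul, map_inv₀, sigma_sigma]
        refine ⟨?_, ?_, ?_, ?_⟩ <;> field_simp
      · rw [eB, coe_monoGL, mono_true_mul_eq_iff, ← hτ]
        simp only [map_one, map_zero, mul_zero, zero_mul, true_and]
        refine ⟨?_, ?_⟩ <;> field_simp
      · exact not_isSquare_mul hN hN0 (not_isSquare_inv hl')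
      · have := not_isSquare_mul (hN.mul (IsSquare.sq (sigma hF (τ l))⁻¹))
          (mul_ne_zero hN0 (pow_ne_zero 2 (inv_ne_zero hσl0))) hμ'
        convert this using 2
        simp only [map_mul, map_inv₀, sigma_sigma]
        field_simp
      · simpa [hu0, hl0, and_comm] using hne

theorem eq_one_of_smul_eq (hodd : Odd q) (hF : Nat.card F = q ^ 2) {z : M hF × M hF}
    (hz : NonSingular hF z) {g : ConjAct (GBar hF)} (hg : g • z = z) : g = 1 := by
  obtain ⟨⟨u, s, i⟩, rfl⟩ := mem_monomialSet_of_smul hodd hF hz g (hg.symm ▸ hz)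
  obtain ⟨A, B, hA, hB, h4, hform⟩ := hz
  have hA' := val_fst_smul hF (ConjAct.toConjAct (cls hF (monoGL u s) i)) z
  have hB' := val_snd_smul hF (ConjAct.toConjAct (cls hF (monoGL u s) i)) z
  dsimp only at hg
  rw [hg, hA, eq_mul_inv_iff_mul_eq, ConjAct.ofConjAct_toConjAct, eq_comm, cls_mul_eq_iff] at hA'
  rw [hg, hB, eq_mul_inv_iff_mul_eq, ConjAct.ofConjAct_toConjAct, eq_comm, cls_mul_eq_iff] at hB'
  rw [not_order_four_iff hodd hF z A B hA hB] at h4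
  suffices h : (u : F) = 1 ∧ s = false ∧ i = 1 by
    obtain ⟨hu, rfl, rfl⟩ := h
    obtain rfl : u = 1 := Units.ext hu
    have : monoGL (1 : Fˣ) false = 1 := by
      apply Units.ext
      rw [coe_monoGL]
      exact Matrix.one_fin_two.symm
    simp only [this, cls_one, map_one]
  rw [coe_monoGL] at hA' hB'
  rcases hform with ⟨⟨l, b, c, hl, -, eB, eA⟩, hne⟩ | ⟨⟨l, a, d, hl, -, eB, eA⟩, hne⟩
  · rw [eA] at hne hA' h4
    rw [eB] at hB' h4
    rw [trace_sq_diagonalA, trace_sq_diagonalB] at h4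
    simp only [Matrix.of_apply, Matrix.cons_val', Matrix.cons_val_zero, Matrix.cons_val_one,
      Matrix.cons_val_fin_one, not_or] at hne
    exact diagonal_stabilizer hodd hF hl hne.2 hne.1
      (fun h => h4 ⟨by rw [h.1, h.2, add_zero], h.1⟩) u s i hB' hA'
  · rw [eA] at hne hA' h4
    rw [eB] at hB' h4
    rw [trace_sq_offDiagonalA, trace_sq_offDiagonalB] at h4
    simp only [Matrix.of_apply, Matrix.cons_val', Matrix.cons_val_zero, Matrix.cons_val_one,
      Matrix.cons_val_fin_one] at hne
    exact offDiagonal_stabilizer hodd hF hl hne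
      (fun h => h4 ⟨by rw [h.1, h.2, sub_zero], h.1⟩) u s i hB' hA'

end MonomialAction

/-! ### Counting parameters -/

section Counting

/-- A self-inverse map of `W` that negates `P` shows that `P` holds on exactly half of `W`. -/
theorem two_mul_ncard_of_flip {α : Type*} [Finite α] {W : Set α} {P : α → Prop} (f : α → α)
    (hf : ∀ x ∈ W, f x ∈ W ∧ f (f x) = x ∧ (P (f x) ↔ ¬ P x)) :
    2 * {x | x ∈ W ∧ P x}.ncard = W.ncard := by
  have hinj : Set.InjOn f {x | x ∈ W ∧ P x} := fun x hx y hy h => by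
    rw [← (hf x hx.1).2.1, h, (hf y hy.1).2.1]
  have hdisj : Disjoint {x | x ∈ W ∧ P x} (f '' {x | x ∈ W ∧ P x}) := by
    rw [Set.disjoint_left]
    rintro _ hx ⟨y, hy, rfl⟩
    exact (hf y hy.1).2.2.1 hx.2 hy.2
  have hW : W = {x | x ∈ W ∧ P x} ∪ f '' {x | x ∈ W ∧ P x} := by
    ext x
    constructor
    · intro hx
      by_cases hP : P x
      · exact Or.inl ⟨hx, hP⟩
      · exact Or.inr ⟨f x, ⟨(hf x hx).1, (hf x hx).2.2.2 hP⟩, (hf x hx).2.1⟩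
    · rintro (hx | ⟨y, hy, rfl⟩)
      · exact hx.1
      · exact (hf y hy.1).1
  conv_rhs => rw [hW]
  rw [Set.ncard_union_eq hdisj, hinj.ncard_image, two_mul]

variable {F : Type*} [Field F]

/-- A set of triples `(l, x, y)` with `x ≠ 0` is counted by the ratios `y / x`. -/
theorem ncard_triples {A B : Set F} {W : Set (F × F × F)}
    (hW : ∀ l x y, (l, x, y) ∈ W ↔ l ∈ A ∧ x ≠ 0 ∧ y / x ∈ B) :
    W.ncard = A.ncard * (({0}ᶜ : Set F).ncard * B.ncard) := by
  rw [← Set.ncard_prod, ← Set.ncard_prod]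
  have hinj : Set.InjOn (fun p : F × F × F => (p.1, p.2.1, p.2.2 / p.2.1)) W := by
    rintro ⟨l, x, y⟩ hp ⟨l', x', y'⟩ - h
    simp only [Prod.mk.injEq] at h
    obtain ⟨rfl, rfl, h⟩ := h
    rw [(div_left_inj' ((hW l x y).1 hp).2.1).1 h]
  rw [← hinj.ncard_image]
  congr 1
  ext ⟨l, x, e⟩
  constructor
  · rintro ⟨⟨l', x', y'⟩, hp, h⟩
    simp only [Prod.mk.injEq] at h
    obtain ⟨rfl, rfl, rfl⟩ := h
    exact (hW _ _ _).1 hp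
  · rintro ⟨h1, h2, h3⟩
    have e' : x * e / x = e := mul_div_cancel_left₀ e h2
    refine ⟨(l, x, x * e), (hW _ _ _).2 ⟨h1, h2, by rwa [e']⟩, ?_⟩
    simp only [e']

variable [Finite F] {q : ℕ}

theorem ncard_ne_zero (hF : Nat.card F = q ^ 2) : ({0}ᶜ : Set F).ncard = q ^ 2 - 1 := by
  rw [Set.ncard_compl, Set.ncard_singleton, hF]

theorem two_mul_ncard_not_isSquare (hodd : Odd q) (hF : Nat.card F = q ^ 2) :
    2 * {x : F | ¬ IsSquare x}.ncard = q ^ 2 - 1 := by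
  obtain ⟨g, hg⟩ := FiniteField.exists_nonsquare (ringChar_ne_two hodd hF)
  have hg0 := ne_zero_of_not_isSquare hg
  rw [← ncard_ne_zero hF]
  have hset : {x : F | ¬ IsSquare x} = {x | x ∈ ({0}ᶜ : Set F) ∧ ¬ IsSquare x} := by
    ext x
    exact ⟨fun hx => ⟨ne_zero_of_not_isSquare hx, hx⟩, And.right⟩
  rw [hset]
  -- `x ↦ g / x` interchanges squares and non-squares for a fixed non-square `g`.
  refine two_mul_ncard_of_flip (fun x => g * x⁻¹) fun x hx => ?_
  have hx' : x ≠ 0 := hx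
  refine ⟨mul_ne_zero hg0 (inv_ne_zero hx'), by field_simp, ?_⟩
  rw [isSquare_mul_iff hg0 (inv_ne_zero hx'), isSquare_inv]
  tauto

/-- The number `-1` is a `d`-th power, by Euler's criterion for a non-square, and its other `d`-th
roots differ from that one by the `d`-th roots of unity. -/
theorem ncard_pow_eq_neg_one (hodd : Odd q) (hF : Nat.card F = q ^ 2) {d e : ℕ}
    (h : q ^ 2 = d * (2 * e) + 1) : {x : F | x ^ d = -1}.ncard = d := by
  have := Fintype.ofFinite F
  obtain ⟨a, ha⟩ := FiniteField.exists_nonsquare (ringChar_ne_two hodd hF)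
  have ha0 := ne_zero_of_not_isSquare ha
  have hx : (a ^ e) ^ d = -1 := by
    have h1 := (FiniteField.pow_dichotomy (ringChar_ne_two hodd hF) ha0).resolve_left fun h1 =>
      ha ((FiniteField.isSquare_iff (ringChar_ne_two hodd hF) ha0).2 h1)
    rw [← Nat.card_eq_fintype_card, hF, h] at h1
    rw [← h1, ← pow_mul]
    congr 1
    have : d * (2 * e) = 2 * (e * d) := by ring
    omega
  have hx0 : a ^ e ≠ 0 := pow_ne_zero e ha0
  have hset : {x : F | x ^ d = -1}
      = (fun u : Fˣ => a ^ e * u) '' ((powMonoidHom d : Fˣ →* Fˣ).ker : Set Fˣ) := by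
    ext x
    simp only [Set.mem_ofPred_eq, Set.mem_image, SetLike.mem_coe, MonoidHom.mem_ker,
      powMonoidHom_apply]
    constructor
    · intro hxd
      have hy0 : x / a ^ e ≠ 0 := by
        refine div_ne_zero ?_ hx0
        rintro rfl
        rcases eq_or_ne d 0 with rfl | hd
        · rw [pow_zero] at hxd hx
          exact one_ne_zero (eq_zero_of_eq_neg hodd hF hxd)
        · rw [zero_pow hd] at hxd
          exact one_ne_zero (neg_eq_zero.1 hxd.symm)
      refine ⟨Units.mk0 _ hy0, ?_, ?_⟩
      · ext
        simp [div_pow, hxd, hx]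
      · simp only [Units.val_mk0]
        field_simp
    · rintro ⟨u, hu, rfl⟩
      have hu' : (u : F) ^ d = 1 := by rw [← Units.val_pow_eq_pow_val, hu, Units.val_one]
      rw [mul_pow, hx, hu', mul_one]
  have hinj : Function.Injective fun u : Fˣ => a ^ e * (u : F) := fun u v huv =>
    Units.ext (mul_left_cancel₀ hx0 huv)
  rw [hset, Set.ncard_image_of_injective _ hinj, ← Nat.card_coe_set_eq]
  refine (IsCyclic.card_powMonoidHom_ker Fˣ d).trans ?_
  rw [Nat.card_units, hF, h, Nat.add_sub_cancel]
  exact Nat.gcd_eq_right (dvd_mul_right d _)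

/-- The parameters `(l, b, c)` of the pairs of diagonal form with `b c ≠ 0`. -/
def diagonalParams (hF : Nat.card F = q ^ 2) : Set (F × F × F) :=
  {p | ¬ IsSquare p.1 ∧ ¬ IsSquare (p.2.1 * p.2.2 + sigma hF p.1) ∧ p.2.1 ≠ 0 ∧ p.2.2 ≠ 0}

/-- The parameters `(l, a, d)` of the pairs of off-diagonal form with `(a, d) ≠ (0, 0)`. -/
def offDiagonalParams (hF : Nat.card F = q ^ 2) : Set (F × F × F) :=
  {p | ¬ IsSquare p.1 ∧ ¬ IsSquare (p.2.1 * p.2.2 + sigma hF p.1) ∧ ¬ (p.2.1 = 0 ∧ p.2.2 = 0)}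

/-- Conditions on `(l, b, c)` under which both members of the diagonal pair have order four. -/
def DiagonalOrderFour (hF : Nat.card F = q ^ 2) (p : F × F × F) : Prop :=
  p.1 * sigma hF p.1 + 1 = 0 ∧ p.2.1 * sigma hF p.2.2 + sigma hF p.2.1 * p.2.2 = 0

/-- Conditions on `(l, a, d)` under which both members of the off-diagonal pair have order
four. -/
def OffDiagonalOrderFour (hF : Nat.card F = q ^ 2) (p : F × F × F) : Prop :=
  p.1 + sigma hF p.1 = 0 ∧ p.2.1 * sigma hF p.2.1 + p.2.2 * sigma hF p.2.2 = 0

/-- Both parameter sets are compared with the triples whose second entry is non-zero; those are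
parametrized by `l`, `b` and the non-square `b c + l ^ σ`. -/
theorem ncard_params (hodd : Odd q) (hF : Nat.card F = q ^ 2) :
    2 * ((diagonalParams hF).ncard + (offDiagonalParams hF).ncard) = (q ^ 2 - 1) ^ 3 := by
  set S : Set F := {x : F | ¬ IsSquare x} with hS
  set U : Set F := {0}ᶜ with hU
  set Y : Set (F × F × F) :=
    {p | ¬ IsSquare p.1 ∧ ¬ IsSquare (p.2.1 * p.2.2 + sigma hF p.1) ∧ p.2.1 ≠ 0} with hY
  have hY_card : Y.ncard = S.ncard * (U.ncard * S.ncard) := by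
    rw [← Set.ncard_prod, ← Set.ncard_prod]
    have hinj : Set.InjOn (fun p : F × F × F => (p.1, p.2.1, p.2.1 * p.2.2 + sigma hF p.1)) Y := by
      rintro ⟨l, b, c⟩ ⟨-, -, hb⟩ ⟨l', b', c'⟩ - h
      simp only [Prod.mk.injEq] at h
      obtain ⟨rfl, rfl, h⟩ := h
      rw [mul_left_cancel₀ hb (add_right_cancel h)]
    rw [← hinj.ncard_image]
    congr 1
    ext ⟨l, b, m⟩
    constructor
    · rintro ⟨p, ⟨h1, h2, h3⟩, h⟩
      simp only [Prod.mk.injEq] at h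
      obtain ⟨rfl, rfl, rfl⟩ := h
      exact ⟨h1, h3, h2⟩
    · rintro ⟨h1, h2, h3⟩
      have e : b * ((m - sigma hF l) / b) + sigma hF l = m := by
        rw [mul_div_cancel₀ _ h2, sub_add_cancel]
      refine ⟨(l, b, (m - sigma hF l) / b), ⟨h1, ?_, h2⟩, ?_⟩
      · dsimp only
        rw [e]
        exact h3
      · simp only [e]
  have hσ {l : F} (hl : ¬ IsSquare l) : ¬ IsSquare (sigma hF l) := by rwa [isSquare_map_iff]
  have hD : (diagonalParams hF).ncard + S.ncard * U.ncard = Y.ncard := by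
    have hinj : Function.Injective fun p : F × F => (p.1, p.2, (0 : F)) := fun p p' h => by
      simpa [Prod.ext_iff] using h
    rw [← Set.ncard_prod, ← Set.ncard_image_of_injective _ hinj, ← Set.ncard_union_eq]
    · congr 1
      ext ⟨l, b, c⟩
      constructor
      · rintro (⟨h1, h2, h3, -⟩ | ⟨p, ⟨h1, h2⟩, h⟩)
        · exact ⟨h1, h2, h3⟩
        · simp only [Prod.mk.injEq] at h
          obtain ⟨rfl, rfl, rfl⟩ := h
          exact ⟨h1, by simpa using hσ h1, h2⟩
      · rintro ⟨h1, h2, h3⟩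
        rcases eq_or_ne c 0 with rfl | hc
        · exact Or.inr ⟨(l, b), ⟨h1, h3⟩, rfl⟩
        · exact Or.inl ⟨h1, h2, h3, hc⟩
    · rw [Set.disjoint_left]
      rintro _ ⟨-, -, -, h⟩ ⟨p, -, rfl⟩
      exact h rfl
  have hO : (offDiagonalParams hF).ncard = Y.ncard + S.ncard * U.ncard := by
    have hinj : Function.Injective fun p : F × F => (p.1, (0 : F), p.2) := fun p p' h => by
      simpa [Prod.ext_iff] using h
    rw [← Set.ncard_prod, ← Set.ncard_image_of_injective _ hinj, ← Set.ncard_union_eq]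
    · congr 1
      ext ⟨l, a, d⟩
      constructor
      · rintro ⟨h1, h2, h3⟩
        rcases eq_or_ne a 0 with rfl | ha
        · exact Or.inr ⟨(l, d), ⟨h1, fun h => h3 ⟨rfl, h⟩⟩, rfl⟩
        · exact Or.inl ⟨h1, h2, ha⟩
      · rintro (⟨h1, h2, h3⟩ | ⟨p, ⟨h1, h2⟩, h⟩)
        · exact ⟨h1, h2, fun h => h3 h.1⟩
        · simp only [Prod.mk.injEq] at h
          obtain ⟨rfl, rfl, rfl⟩ := h
          exact ⟨h1, by simpa using hσ h1, fun h => h2 h.2⟩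
    · rw [Set.disjoint_left]
      rintro _ ⟨-, -, h⟩ ⟨p, -, rfl⟩
      exact h rfl
  have hS_card := two_mul_ncard_not_isSquare hodd hF
  have hU_card := ncard_ne_zero hF
  rw [← hS] at hS_card
  rw [← hU] at hU_card
  calc 2 * ((diagonalParams hF).ncard + (offDiagonalParams hF).ncard)
      = 2 * (((diagonalParams hF).ncard + S.ncard * U.ncard) + Y.ncard) := by rw [hO]; ring
    _ = (2 * S.ncard) * (2 * S.ncard) * U.ncard := by rw [hD, hY_card]; ring
    _ = (q ^ 2 - 1) ^ 3 := by rw [hS_card, hU_card]; ring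

theorem norm_eq_pow {m : ℕ} (hF : Nat.card F = (2 * m + 1) ^ 2) (x : F) :
    x * sigma hF x = x ^ (2 * m + 2) := by
  rw [sigma_apply]
  ring

/-- The non-zero elements of trace zero are the solutions of `x ^ (q - 1) = -1`. -/
theorem trace_eq_zero_iff {m : ℕ} (hF : Nat.card F = (2 * m + 1) ^ 2) {x : F} (hx : x ≠ 0) :
    x + sigma hF x = 0 ↔ x ^ (2 * m) = -1 := by
  rw [sigma_apply, show x + x ^ (2 * m + 1) = x * (x ^ (2 * m) + 1) by ring, mul_eq_zero,
    or_iff_right hx, add_eq_zero_iff_eq_neg]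

theorem ncard_norm_eq_neg_one {m : ℕ} (hF : Nat.card F = (2 * m + 1) ^ 2) :
    {x : F | x * sigma hF x + 1 = 0}.ncard = 2 * m + 2 := by
  simp only [norm_eq_pow, add_eq_zero_iff_eq_neg]
  exact ncard_pow_eq_neg_one ⟨m, rfl⟩ hF (e := m) (by ring)

theorem ncard_trace_eq_zero {m : ℕ} (hF : Nat.card F = (2 * m + 1) ^ 2) :
    {x : F | x ≠ 0 ∧ x + sigma hF x = 0}.ncard = 2 * m := by
  have hset : {x : F | x ≠ 0 ∧ x + sigma hF x = 0} = {x : F | x ^ (2 * m) = -1} := by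
    ext x
    constructor
    · rintro ⟨hx, h⟩
      exact (trace_eq_zero_iff hF hx).1 h
    · intro h
      have hx : x ≠ 0 := by
        rintro rfl
        rcases eq_or_ne m 0 with rfl | hm
        · have := Nat.card_eq_one_iff_unique.1 (hF.trans (by norm_num))
          exact zero_ne_one (this.1.elim (0 : F) 1)
        · have h' : (0 : F) ^ (2 * m) = -1 := h
          rw [zero_pow (by omega)] at h'
          exact one_ne_zero (neg_eq_zero.1 h'.symm)
      exact ⟨hx, (trace_eq_zero_iff hF hx).2 h⟩
  rw [hset]
  exact ncard_pow_eq_neg_one ⟨m, rfl⟩ hF (e := m + 1) (by ring)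

/-- The triples excluded from the diagonal form, before imposing that `b c + l ^ σ` be a
non-square. -/
def diagonalTriples (hF : Nat.card F = q ^ 2) : Set (F × F × F) :=
  {p | p.2.1 ≠ 0 ∧ p.2.2 ≠ 0 ∧ DiagonalOrderFour hF p}

/-- The triples excluded from the off-diagonal form, before imposing that `a d + l ^ σ` be a
non-square. -/
def offDiagonalTriples (hF : Nat.card F = q ^ 2) : Set (F × F × F) :=
  {p | p.1 ≠ 0 ∧ p.2.1 ≠ 0 ∧ p.2.2 ≠ 0 ∧ OffDiagonalOrderFour hF p}

theorem ncard_diagonalTriples (hodd : Odd q) (hF : Nat.card F = q ^ 2) :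
    (diagonalTriples hF).ncard = (q ^ 2 - 1) ^ 2 := by
  obtain ⟨m, rfl⟩ := hodd
  rw [ncard_triples (A := {x : F | x * sigma hF x + 1 = 0})
    (B := {x : F | x ≠ 0 ∧ x + sigma hF x = 0}), ncard_norm_eq_neg_one, ncard_trace_eq_zero,
    ncard_ne_zero hF]
  · have : (2 * m + 1) ^ 2 - 1 = (2 * m + 2) * (2 * m) := by
      rw [show (2 * m + 1) ^ 2 = (2 * m + 2) * (2 * m) + 1 by ring, Nat.add_sub_cancel]
    rw [this]
    ring
  · intro l b c
    simp only [diagonalTriples, DiagonalOrderFour, Set.mem_ofPred_eq]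
    by_cases hb : b = 0
    · simp [hb]
    have hσb : sigma hF b ≠ 0 := (map_ne_zero _).2 hb
    have key : c / b + sigma hF (c / b) = 0 ↔ b * sigma hF c + sigma hF b * c = 0 := by
      rw [map_div₀, div_add_div _ _ hb hσb, div_eq_zero_iff, or_iff_left (mul_ne_zero hb hσb),
        add_comm, mul_comm c]
    rw [key, div_ne_zero_iff]
    tauto

theorem ncard_offDiagonalTriples (hodd : Odd q) (hF : Nat.card F = q ^ 2) :
    (offDiagonalTriples hF).ncard = (q ^ 2 - 1) ^ 2 := by
  obtain ⟨m, rfl⟩ := hodd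
  rw [ncard_triples (A := {x : F | x ≠ 0 ∧ x + sigma hF x = 0})
    (B := {x : F | x * sigma hF x + 1 = 0}), ncard_norm_eq_neg_one, ncard_trace_eq_zero,
    ncard_ne_zero hF]
  · have : (2 * m + 1) ^ 2 - 1 = (2 * m + 2) * (2 * m) := by
      rw [show (2 * m + 1) ^ 2 = (2 * m + 2) * (2 * m) + 1 by ring, Nat.add_sub_cancel]
    rw [this]
    ring
  · intro l a d
    simp only [offDiagonalTriples, OffDiagonalOrderFour, Set.mem_ofPred_eq]
    by_cases ha : a = 0
    · simp [ha]
    have hσa : sigma hF a ≠ 0 := (map_ne_zero _).2 ha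
    have key : d / a * sigma hF (d / a) + 1 = 0 ↔ a * sigma hF a + d * sigma hF d = 0 := by
      rw [map_div₀, div_mul_div_comm, div_add_one (mul_ne_zero ha hσa), div_eq_zero_iff,
        or_iff_left (mul_ne_zero ha hσa), add_comm]
    rw [key]
    have hd : a * sigma hF a + d * sigma hF d = 0 → d ≠ 0 := by
      rintro h rfl
      rw [zero_mul, add_zero] at h
      exact mul_ne_zero ha hσa h
    tauto

/-- The inversion `(b, c) ↦ (l ^ σ / c, l ^ σ / b)` multiplies `b c + l ^ σ` by `l ^ σ / (b c)`,
a non-square because `b c` is a square when `q ≡ 3 (mod 4)`. -/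
theorem two_mul_ncard_diagonalOrderFour {m : ℕ} (hm : Odd m) (hF : Nat.card F = (2 * m + 1) ^ 2) :
    2 * {p | p ∈ diagonalParams hF ∧ DiagonalOrderFour hF p}.ncard
      = (diagonalTriples hF).ncard := by
  have hodd : Odd (2 * m + 1) := ⟨m, rfl⟩
  have hl_ne {l : F} (h : l * sigma hF l + 1 = 0) : l ≠ 0 := by
    rintro rfl
    rw [zero_mul, zero_add] at h
    exact one_ne_zero h
  have hl_nsq {l : F} (h : l * sigma hF l + 1 = 0) : ¬ IsSquare l := by
    rw [isSquare_iff_pow_eq_one hF (hl_ne h), pow_mul, ← norm_eq_pow hF,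
      eq_neg_of_add_eq_zero_left h, hm.neg_one_pow]
    exact fun h => one_ne_zero (eq_zero_of_eq_neg hodd hF h.symm)
  have hset : {p | p ∈ diagonalParams hF ∧ DiagonalOrderFour hF p}
      = {p | p ∈ diagonalTriples hF ∧ ¬ IsSquare (p.2.1 * p.2.2 + sigma hF p.1)} := by
    ext p
    constructor
    · rintro ⟨⟨-, h2, h3, h4⟩, h5⟩
      exact ⟨⟨h3, h4, h5⟩, h2⟩
    · rintro ⟨⟨h3, h4, h5⟩, h2⟩
      exact ⟨⟨hl_nsq h5.1, h2, h3, h4⟩, h5⟩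
  rw [hset]
  refine two_mul_ncard_of_flip
    (fun p => (p.1, sigma hF p.1 / p.2.2, sigma hF p.1 / p.2.1)) ?_
  rintro ⟨l, b, c⟩ ⟨hb, hc, h1, h2⟩
  dsimp only at hb hc h1 h2 ⊢
  have hl0 := hl_ne h1
  have hσl0 : sigma hF l ≠ 0 := (map_ne_zero _).2 hl0
  have hσb : sigma hF b ≠ 0 := (map_ne_zero _).2 hb
  have hσc : sigma hF c ≠ 0 := (map_ne_zero _).2 hc
  have hbc0 := mul_ne_zero hb hc
  have hbc : IsSquare (b * c) := by
    set t := b * sigma hF c with ht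
    have hσt : t + sigma hF t = 0 := by
      rw [ht, map_mul, sigma_sigma]
      exact h2
    have ht' := (trace_eq_zero_iff hF (mul_ne_zero hb hσc)).1 hσt
    have hN : (b * c) ^ (2 * m + 2) = -t ^ 2 := by
      rw [← norm_eq_pow hF, map_mul]
      linear_combination t * h2
    rw [isSquare_iff_pow_eq_one hF hbc0, pow_mul, hN, hm.neg_pow, ← pow_mul, ht', neg_neg]
  have hl' : ¬ IsSquare (sigma hF l) := by
    rw [isSquare_map_iff]
    exact hl_nsq h1
  have hμ : b * c + sigma hF l ≠ 0 := fun h => by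
    rw [eq_neg_of_add_eq_zero_left h, isSquare_neg_iff hodd hF] at hbc
    exact hl' hbc
  refine ⟨⟨div_ne_zero hσl0 hc, div_ne_zero hσl0 hb, h1, ?_⟩, ?_, ?_⟩
  · dsimp only
    rw [map_div₀, map_div₀, sigma_sigma]
    field_simp
    linear_combination l * sigma hF l * h2
  · ext <;> dsimp only <;> field_simp
  · have e : sigma hF l / c * (sigma hF l / b) + sigma hF l
        = (b * c + sigma hF l) * (sigma hF l * (b * c)⁻¹) := by
      field_simp
      ring
    rw [e, isSquare_mul_iff hμ (mul_ne_zero hσl0 (inv_ne_zero hbc0)),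
      isSquare_mul_iff hσl0 (inv_ne_zero hbc0), isSquare_inv]
    tauto

/-- The inversion `(a, d) ↦ (l / d, l / a)` multiplies `a d + l ^ σ` by `-l / (a d)`, a non-square
because `a d` is a square when `q ≡ 1 (mod 4)`. -/
theorem two_mul_ncard_offDiagonalOrderFour {m : ℕ} (hm : Even m)
    (hF : Nat.card F = (2 * m + 1) ^ 2) :
    2 * {p | p ∈ offDiagonalParams hF ∧ OffDiagonalOrderFour hF p}.ncard
      = (offDiagonalTriples hF).ncard := by
  have hodd : Odd (2 * m + 1) := ⟨m, rfl⟩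
  have hl_nsq {l : F} (hl : l ≠ 0) (h : l + sigma hF l = 0) : ¬ IsSquare l := by
    rw [isSquare_iff_pow_eq_one hF hl,
      show (2 * m + 2) * m = 2 * m * (m + 1) by ring, pow_mul, (trace_eq_zero_iff hF hl).1 h,
      hm.add_one.neg_one_pow]
    exact fun h => one_ne_zero (eq_zero_of_eq_neg hodd hF h.symm)
  have hset : {p | p ∈ offDiagonalParams hF ∧ OffDiagonalOrderFour hF p}
      = {p | p ∈ offDiagonalTriples hF ∧ ¬ IsSquare (p.2.1 * p.2.2 + sigma hF p.1)} := by
    ext ⟨l, a, d⟩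
    constructor
    · rintro ⟨⟨h1, h2, h3⟩, h4, h5⟩
      dsimp only at h1 h2 h3 h4 h5
      refine ⟨⟨ne_zero_of_not_isSquare h1, ?_, ?_, h4, h5⟩, h2⟩
      · rintro rfl
        simp only [map_zero, mul_zero, zero_add, mul_eq_zero, map_eq_zero,
          or_self] at h5
        exact h3 ⟨rfl, h5⟩
      · rintro rfl
        simp only [map_zero, mul_zero, add_zero, mul_eq_zero, map_eq_zero,
          or_self] at h5
        exact h3 ⟨h5, rfl⟩
    · rintro ⟨⟨h1, h3, h4, h5⟩, h2⟩
      exact ⟨⟨hl_nsq h1 h5.1, h2, fun h => h3 h.1⟩, h5⟩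
  rw [hset]
  refine two_mul_ncard_of_flip (fun p => (p.1, p.1 / p.2.2, p.1 / p.2.1)) ?_
  rintro ⟨l, a, d⟩ ⟨hl0, ha, hd, h1, h2⟩
  dsimp only at hl0 ha hd h1 h2 ⊢
  have hσl : sigma hF l = -l := eq_neg_of_add_eq_zero_right h1
  have hσa : sigma hF a ≠ 0 := (map_ne_zero _).2 ha
  have hσd : sigma hF d ≠ 0 := (map_ne_zero _).2 hd
  have had0 := mul_ne_zero ha hd
  have had : IsSquare (a * d) := by
    set t := d * sigma hF d with ht
    have ht0 : t ≠ 0 := mul_ne_zero hd hσd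
    have ht' : t ^ (2 * m) = 1 := by
      refine mul_right_cancel₀ ht0 ?_
      rw [one_mul, ← pow_succ, ← sigma_apply hF, ht, map_mul, sigma_sigma, mul_comm]
    have hN : (a * d) ^ (2 * m + 2) = -t ^ 2 := by
      rw [← norm_eq_pow hF, map_mul]
      linear_combination t * h2
    rw [isSquare_iff_pow_eq_one hF had0, pow_mul, hN, hm.neg_pow, ← pow_mul, ht']
  have hl' : ¬ IsSquare (-l) := by
    rw [isSquare_neg_iff hodd hF]
    exact hl_nsq hl0 h1
  rw [hσl]
  have hμ : a * d + -l ≠ 0 := fun h => by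
    rw [eq_neg_of_add_eq_zero_left h, isSquare_neg_iff hodd hF] at had
    exact hl' had
  refine ⟨⟨hl0, div_ne_zero hl0 hd, div_ne_zero hl0 ha, h1, ?_⟩, ?_, ?_⟩
  · dsimp only
    rw [map_div₀, map_div₀, hσl]
    field_simp
    linear_combination -l ^ 2 * h2
  · ext <;> dsimp only <;> field_simp
  · have e : l / d * (l / a) + -l = (a * d + -l) * (-l * (a * d)⁻¹) := by
      field_simp
      ring
    rw [e, isSquare_mul_iff hμ (mul_ne_zero (neg_ne_zero.2 hl0) (inv_ne_zero had0)),
      isSquare_mul_iff (neg_ne_zero.2 hl0) (inv_ne_zero had0), isSquare_inv]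
    tauto

/-- For `q ≡ 3 (mod 4)` all excluded pairs are of diagonal form, since a trace-zero `l` is then a
square; for `q ≡ 1 (mod 4)` all are of off-diagonal form, since an `l` of norm `-1` is then a
square. -/
theorem two_mul_ncard_orderFour (hodd : Odd q) (hF : Nat.card F = q ^ 2) :
    2 * ({p | p ∈ diagonalParams hF ∧ DiagonalOrderFour hF p}.ncard +
      {p | p ∈ offDiagonalParams hF ∧ OffDiagonalOrderFour hF p}.ncard) = (q ^ 2 - 1) ^ 2 := by
  obtain ⟨m, rfl⟩ := id hodd
  rcases Nat.even_or_odd m with hm | hm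
  · have h0 : {p | p ∈ diagonalParams hF ∧ DiagonalOrderFour hF p} = ∅ := by
      rw [Set.eq_empty_iff_forall_notMem]
      rintro ⟨l, b, c⟩ ⟨⟨hl, -⟩, h, -⟩
      refine hl ?_
      rw [isSquare_iff_pow_eq_one hF (ne_zero_of_not_isSquare hl), pow_mul, ← norm_eq_pow hF,
        eq_neg_of_add_eq_zero_left h, hm.neg_one_pow]
    rw [h0, Set.ncard_empty, zero_add, two_mul_ncard_offDiagonalOrderFour hm,
      ncard_offDiagonalTriples hodd]
  · have h0 : {p | p ∈ offDiagonalParams hF ∧ OffDiagonalOrderFour hF p} = ∅ := by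
      rw [Set.eq_empty_iff_forall_notMem]
      rintro ⟨l, a, d⟩ ⟨⟨hl, -⟩, h, -⟩
      refine hl ?_
      rw [isSquare_iff_pow_eq_one hF (ne_zero_of_not_isSquare hl),
        show (2 * m + 2) * m = 2 * m * (m + 1) by ring, pow_mul,
        (trace_eq_zero_iff hF (ne_zero_of_not_isSquare hl)).1 h, hm.add_one.neg_one_pow]
    rw [h0, Set.ncard_empty, add_zero, two_mul_ncard_diagonalOrderFour hm,
      ncard_diagonalTriples hodd]

end Counting

/-! ### Non-singular pairs and their parameters -/

section Parametrization

variable {F : Type*} [Field F] [Finite F] {q : ℕ}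

open Classical in
/-- The class `[A, 1]` of a matrix `A`; the value at a singular matrix is immaterial. -/
noncomputable def matrixCls (hF : Nat.card F = q ^ 2) (A : Matrix (Fin 2) (Fin 2) F) : GBar hF :=
  if h : A.det ≠ 0 then cls hF (Matrix.GeneralLinearGroup.mkOfDetNeZero A h) Z2.one else 1

theorem matrixCls_of_det_ne_zero (hF : Nat.card F = q ^ 2) {A : Matrix (Fin 2) (Fin 2) F}
    (h : A.det ≠ 0) :
    matrixCls hF A = cls hF (Matrix.GeneralLinearGroup.mkOfDetNeZero A h) Z2.one :=
  dif_pos h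

theorem matrixCls_coe (hF : Nat.card F = q ^ 2) (A : GL (Fin 2) F) :
    matrixCls hF A.val = cls hF A Z2.one := by
  rw [matrixCls_of_det_ne_zero hF (det_coe_ne_zero A)]
  congr 1
  exact Units.ext rfl

theorem matrixCls_eq (hF : Nat.card F = q ^ 2) {A B : Matrix (Fin 2) (Fin 2) F}
    (hA : A.det ≠ 0) (hB : B.det ≠ 0) (h : matrixCls hF A = matrixCls hF B) :
    ∃ k : F, k ≠ 0 ∧ A = k • B := by
  rw [matrixCls_of_det_ne_zero hF hA, matrixCls_of_det_ne_zero hF hB, cls_eq_iff] at h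
  exact h.2

theorem cls_mem_M (hF : Nat.card F = q ^ 2) {A : GL (Fin 2) F} (h : ¬ IsSquare A.val.det) :
    cls hF A Z2.one ∈ M hF :=
  ⟨⟨A, Z2.one⟩, (mem_K hF _).2 (if_neg h).symm, rfl⟩

/-- The pair of diagonal form with parameters `(l, b, c)`. -/
noncomputable def diagonalPair (hF : Nat.card F = q ^ 2) (p : F × F × F) : GBar hF × GBar hF :=
  (matrixCls hF !![-1, p.2.1; p.2.2, sigma hF p.1], matrixCls hF !![p.1, 0; 0, 1])

/-- The pair of off-diagonal form with parameters `(l, a, d)`. -/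
noncomputable def offDiagonalPair (hF : Nat.card F = q ^ 2) (p : F × F × F) : GBar hF × GBar hF :=
  (matrixCls hF !![p.2.1, sigma hF p.1; -1, p.2.2], matrixCls hF !![0, p.1; 1, 0])

theorem diagonalForm_of_mem (hF : Nat.card F = q ^ 2) {p : F × F × F}
    (hp : p ∈ diagonalParams hF) :
    DiagonalForm hF !![-1, p.2.1; p.2.2, sigma hF p.1] !![p.1, 0; 0, 1] :=
  ⟨_, _, _, hp.1, hp.2.1, rfl, rfl⟩

theorem offDiagonalForm_of_mem (hF : Nat.card F = q ^ 2) {p : F × F × F}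
    (hp : p ∈ offDiagonalParams hF) :
    OffDiagonalForm hF !![p.2.1, sigma hF p.1; -1, p.2.2] !![0, p.1; 1, 0] :=
  ⟨_, _, _, hp.1, hp.2.1, rfl, rfl⟩

/-- The entry `1` of `B` and the entry `-1` of `A` make the scalars unique. -/
theorem injOn_diagonalPair (hodd : Odd q) (hF : Nat.card F = q ^ 2) :
    Set.InjOn (diagonalPair hF) (diagonalParams hF) := by
  rintro ⟨l, b, c⟩ hp ⟨l', b', c'⟩ hp' h
  have hd := det_ne_zero_of_form hodd hF (Or.inl (diagonalForm_of_mem hF hp))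
  have hd' := det_ne_zero_of_form hodd hF (Or.inl (diagonalForm_of_mem hF hp'))
  obtain ⟨hA, hB⟩ := Prod.ext_iff.1 h
  obtain ⟨k, -, eA⟩ := matrixCls_eq hF (ne_zero_of_not_isSquare hd.1)
    (ne_zero_of_not_isSquare hd'.1) hA
  obtain ⟨k', -, eB⟩ := matrixCls_eq hF (ne_zero_of_not_isSquare hd.2)
    (ne_zero_of_not_isSquare hd'.2) hB
  rw [← Matrix.ext_iff] at eA eB
  simp [Fin.forall_fin_two] at eA eB
  obtain ⟨⟨rfl, rfl⟩, rfl, -⟩ := eA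
  obtain ⟨rfl, rfl⟩ := eB
  simp

theorem injOn_offDiagonalPair (hodd : Odd q) (hF : Nat.card F = q ^ 2) :
    Set.InjOn (offDiagonalPair hF) (offDiagonalParams hF) := by
  rintro ⟨l, a, d⟩ hp ⟨l', a', d'⟩ hp' h
  have hd := det_ne_zero_of_form hodd hF (Or.inr (offDiagonalForm_of_mem hF hp))
  have hd' := det_ne_zero_of_form hodd hF (Or.inr (offDiagonalForm_of_mem hF hp'))
  obtain ⟨hA, hB⟩ := Prod.ext_iff.1 h
  obtain ⟨k, -, eA⟩ := matrixCls_eq hF (ne_zero_of_not_isSquare hd.1)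
    (ne_zero_of_not_isSquare hd'.1) hA
  obtain ⟨k', -, eB⟩ := matrixCls_eq hF (ne_zero_of_not_isSquare hd.2)
    (ne_zero_of_not_isSquare hd'.2) hB
  rw [← Matrix.ext_iff] at eA eB
  simp [Fin.forall_fin_two] at eA eB
  obtain ⟨⟨rfl, -⟩, rfl, rfl⟩ := eA
  obtain ⟨rfl, rfl⟩ := eB
  simp

theorem diagonalPair_ne_offDiagonalPair (hodd : Odd q) (hF : Nat.card F = q ^ 2)
    {p p' : F × F × F} (hp : p ∈ diagonalParams hF) (hp' : p' ∈ offDiagonalParams hF) :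
    diagonalPair hF p ≠ offDiagonalPair hF p' := by
  intro h
  have hd := det_ne_zero_of_form hodd hF (Or.inl (diagonalForm_of_mem hF hp))
  have hd' := det_ne_zero_of_form hodd hF (Or.inr (offDiagonalForm_of_mem hF hp'))
  obtain ⟨k, -, eB⟩ := matrixCls_eq hF (ne_zero_of_not_isSquare hd.2)
    (ne_zero_of_not_isSquare hd'.2) (Prod.ext_iff.1 h).2
  rw [← Matrix.ext_iff] at eB
  simp [Fin.forall_fin_two] at eB

theorem not_order_four_diagonal (hF : Nat.card F = q ^ 2) (p : F × F × F) :
    ¬ ((!![-1, p.2.1; p.2.2, sigma hF p.1] *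
      (!![-1, p.2.1; p.2.2, sigma hF p.1] : Matrix (Fin 2) (Fin 2) F).map (sigma hF)).trace = 0 ∧
      (!![p.1, 0; 0, 1] *
        (!![p.1, 0; 0, 1] : Matrix (Fin 2) (Fin 2) F).map (sigma hF)).trace = 0)
      ↔ ¬ DiagonalOrderFour hF p := by
  rw [trace_sq_diagonalA, trace_sq_diagonalB, DiagonalOrderFour, not_iff_not]
  exact ⟨fun ⟨h1, h2⟩ => ⟨h2, by rwa [h2, zero_add] at h1⟩,
    fun ⟨h1, h2⟩ => ⟨by rw [h1, h2, add_zero], h1⟩⟩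

theorem not_order_four_offDiagonal (hF : Nat.card F = q ^ 2) (p : F × F × F) :
    ¬ ((!![p.2.1, sigma hF p.1; -1, p.2.2] *
      (!![p.2.1, sigma hF p.1; -1, p.2.2] : Matrix (Fin 2) (Fin 2) F).map (sigma hF)).trace = 0 ∧
      (!![0, p.1; 1, 0] *
        (!![0, p.1; 1, 0] : Matrix (Fin 2) (Fin 2) F).map (sigma hF)).trace = 0)
      ↔ ¬ OffDiagonalOrderFour hF p := by
  rw [trace_sq_offDiagonalA, trace_sq_offDiagonalB, OffDiagonalOrderFour, not_iff_not]
  exact ⟨fun ⟨h1, h2⟩ => ⟨h2, by rwa [h2, sub_zero] at h1⟩,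
    fun ⟨h1, h2⟩ => ⟨by rw [h1, h2, sub_zero], h1⟩⟩

/-- A pair of matrices of one of the two forms gives a non-singular pair as soon as the remaining
conditions hold. -/
theorem mem_image_nonSingular (hodd : Odd q) (hF : Nat.card F = q ^ 2)
    {A B : Matrix (Fin 2) (Fin 2) F}
    (hform : (DiagonalForm hF A B ∧ ¬ (A 1 0 = 0 ∨ A 0 1 = 0)) ∨
      (OffDiagonalForm hF A B ∧ ¬ (A 0 0 = 0 ∧ A 1 1 = 0)))
    (h4 : ¬ ((A * A.map (sigma hF)).trace = 0 ∧ (B * B.map (sigma hF)).trace = 0)) :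
    (matrixCls hF A, matrixCls hF B) ∈ (fun z : M hF × M hF => ((z.1 : GBar hF), (z.2 : GBar hF)))
      '' {z | NonSingular hF z} := by
  have hd := det_ne_zero_of_form hodd hF (hform.imp And.left And.left)
  have hA := ne_zero_of_not_isSquare hd.1
  have hB := ne_zero_of_not_isSquare hd.2
  refine ⟨(⟨_, cls_mem_M hF (A := Matrix.GeneralLinearGroup.mkOfDetNeZero A hA) hd.1⟩,
    ⟨_, cls_mem_M hF (A := Matrix.GeneralLinearGroup.mkOfDetNeZero B hB) hd.2⟩),
    ⟨_, _, rfl, rfl, (not_order_four_iff hodd hF _ _ _ rfl rfl).2 h4, hform⟩, ?_⟩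
  rw [matrixCls_of_det_ne_zero hF hA, matrixCls_of_det_ne_zero hF hB]

theorem image_nonSingular (hodd : Odd q) (hF : Nat.card F = q ^ 2) :
    (fun z : M hF × M hF => ((z.1 : GBar hF), (z.2 : GBar hF))) '' {z | NonSingular hF z}
      = diagonalPair hF '' {p | p ∈ diagonalParams hF ∧ ¬ DiagonalOrderFour hF p} ∪
        offDiagonalPair hF '' {p | p ∈ offDiagonalParams hF ∧ ¬ OffDiagonalOrderFour hF p} := by
  ext w
  constructor
  · rintro ⟨z, ⟨A, B, hA, hB, h4, hform⟩, rfl⟩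
    rw [not_order_four_iff hodd hF z A B hA hB] at h4
    dsimp only
    rw [hA, hB, ← matrixCls_coe, ← matrixCls_coe]
    rcases hform with ⟨⟨l, b, c, hl, hμ, eB, eA⟩, hne⟩ | ⟨⟨l, a, d, hl, hμ, eB, eA⟩, hne⟩
    · rw [eA] at hne
      simp only [Matrix.of_apply, Matrix.cons_val', Matrix.cons_val_zero, Matrix.cons_val_one,
        Matrix.cons_val_fin_one, not_or] at hne
      rw [eA, eB] at h4 ⊢
      exact Or.inl ⟨(l, b, c), ⟨⟨hl, hμ, hne.2, hne.1⟩,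
        (not_order_four_diagonal hF (l, b, c)).1 h4⟩, rfl⟩
    · rw [eA] at hne
      simp only [Matrix.of_apply, Matrix.cons_val', Matrix.cons_val_zero, Matrix.cons_val_one,
        Matrix.cons_val_fin_one] at hne
      rw [eA, eB] at h4 ⊢
      exact Or.inr ⟨(l, a, d), ⟨⟨hl, hμ, hne⟩,
        (not_order_four_offDiagonal hF (l, a, d)).1 h4⟩, rfl⟩
  · rintro (⟨p, ⟨hp, h4⟩, rfl⟩ | ⟨p, ⟨hp, h4⟩, rfl⟩)
    · refine mem_image_nonSingular hodd hF (Or.inl ⟨diagonalForm_of_mem hF hp, ?_⟩)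
        ((not_order_four_diagonal hF p).2 h4)
      rintro (h | h)
      · exact hp.2.2.2 h
      · exact hp.2.2.1 h
    · exact mem_image_nonSingular hodd hF (Or.inr ⟨offDiagonalForm_of_mem hF hp, hp.2.2⟩)
        ((not_order_four_offDiagonal hF p).2 h4)

theorem two_mul_ncard_nonSingular (hodd : Odd q) (hF : Nat.card F = q ^ 2) :
    2 * {z : M hF × M hF | NonSingular hF z}.ncard + (q ^ 2 - 1) ^ 2 = (q ^ 2 - 1) ^ 3 := by
  have hinj : Function.Injective
      fun z : M hF × M hF => ((z.1 : GBar hF), (z.2 : GBar hF)) := fun z w h =>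
    Prod.ext (Subtype.ext (Prod.ext_iff.1 h).1) (Subtype.ext (Prod.ext_iff.1 h).2)
  have hfin : Finite (GL (Fin 2) F) := inferInstance
  have hJ : Finite (J hF) := Finite.of_equiv _ SemidirectProduct.equivProd.symm
  have hsplit (S : Set (F × F × F)) (P : F × F × F → Prop) :
      {p | p ∈ S ∧ P p}.ncard + {p | p ∈ S ∧ ¬ P p}.ncard = S.ncard :=
    Set.ncard_inter_add_ncard_sdiff_eq_ncard S {p | P p}
  rw [← Set.ncard_image_of_injective _ hinj, image_nonSingular hodd hF, Set.ncard_union_eq,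
    ((injOn_diagonalPair hodd hF).mono fun _ h => h.1).ncard_image,
    ((injOn_offDiagonalPair hodd hF).mono fun _ h => h.1).ncard_image]
  · have h1 := two_mul_ncard_orderFour hodd hF
    have h2 := ncard_params hodd hF
    have h3 := hsplit (diagonalParams hF) (DiagonalOrderFour hF)
    have h4 := hsplit (offDiagonalParams hF) (OffDiagonalOrderFour hF)
    omega
  · rw [Set.disjoint_left]
    rintro _ ⟨p, hp, rfl⟩ ⟨p', hp', h⟩
    exact diagonalPair_ne_offDiagonalPair hodd hF hp.1 hp'.1 h.symm

theorem ncard_nonSingularOrbits_mul (hodd : Odd q) (hF : Nat.card F = q ^ 2) :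
    (nonSingularOrbits hF).ncard * (4 * (q ^ 2 - 1))
      = {z : M hF × M hF | NonSingular hF z}.ncard := by
  have hfin : Finite (GL (Fin 2) F) := inferInstance
  have hJ : Finite (J hF) := Finite.of_equiv _ SemidirectProduct.equivProd.symm
  rw [← ncard_monomialSet hF]
  exact ncard_orbits_mul_ncard (fun z hz g hg => nonSingular_smul_of_mem hodd hF hz hg)
    (fun z hz g hg => mem_monomialSet_of_smul hodd hF hz g hg)
    (fun z hz g hg => eq_one_of_smul_eq hodd hF hz hg)

end Parametrization

end TwistedLinear

theorem mainTheorem6 {F : Type*} [Field F] [Finite F] (q : ℕ) (hq : IsPrimePow q) (hodd : Odd q)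
    (hF : Nat.card F = q ^ 2) :
    ((TwistedLinear.nonSingularOrbits hF).ncard : ℚ) = ((q : ℚ) ^ 2 - 1) * ((q : ℚ) ^ 2 - 2) / 8 := by
  have h1 := TwistedLinear.two_mul_ncard_nonSingular hodd hF
  rw [← TwistedLinear.ncard_nonSingularOrbits_mul hodd hF] at h1
  have hq2 : 2 ≤ q := hq.two_le
  have hle : 1 ≤ q ^ 2 := Nat.one_le_pow _ _ (by omega)
  have hN : ((q ^ 2 - 1 : ℕ) : ℚ) = (q : ℚ) ^ 2 - 1 := by
    rw [Nat.cast_sub hle]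
    simp
  have hN0 : (q : ℚ) ^ 2 - 1 ≠ 0 := by
    rw [← hN, Nat.cast_ne_zero]
    have : 2 ^ 2 ≤ q ^ 2 := Nat.pow_le_pow_left hq2 2
    omega
  have h2 := congrArg (Nat.cast : ℕ → ℚ) h1
  push_cast [hN] at h2
  rw [eq_div_iff (by norm_num)]
  refine mul_right_cancel₀ hN0 ?_
  linear_combination h2
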